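/- Let $\mathbb F$ be an algebraically closed field and let $q\in\mathbb F$ be nonzero and not a root of unity. Let $\triangle_q$ be the universal Askey--Wilson algebra, i.e. the unital associative $\mathbb F$-algebra with generators $A,B,C$ and relations saying that each of $$A+\frac{qBC-q^{-1}CB}{q^2-q^{-2}},\qquad B+\frac{qCA-q^{-1}AC}{q^2-q^{-2}},\qquad C+\frac{qAB-q^{-1}BA}{q^2-q^{-2}}$$ commutes with $A,B,C$. Let $\mathfrak H_q$ be the universal double affine Hecke algebra of type $(C_1^\vee,C_1)$, i.e. the unital associative $\mathbb F$-algebra with generators $t_i^{\pm1}$ ($i=0,1,2,3$) and relations $t_it_i^{-1}=t_i^{-1}t_i=1$, $t_i+t_i^{-1}$ is central ($i=0,1,2,3$), and $t_0t_1t_2t_3=q^{-1}$. Let $\zeta:\triangle_q\to\mathfrak H_q$ be the $\mathbb F$-algebra homomorphism with $$A\mapsto t_1t_0+(t_1t_0)^{-1},\qquad B\mapsto t_3t_0+(t_3t_0)^{-1},\qquad C\mapsto t_2t_0+(t_2t_0)^{-1};$$ every $\mathfrak H_q$-module is viewed as a $\triangle_q$-module by pulling back via $\zeta$. Let $V$ be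 a finite-dimensional irreducible $\mathfrak H_q$-module and, for $\theta\in\mathbb F$, let $V(\theta)=\{v\in V : t_0v=\theta v\}$, which is a $\triangle_q$-submodule of $V$. Then the following hold. (i) Suppose that $t_0$ is not diagonalizable on $V$. Then $t_0$ has a unique eigenvalue $\theta$ in $V$, and $\theta\in\{\pm1\}$. Moreover: (a) If $\dim V$ is even, then the $\triangle_q$-submodules of $V$ are exactly the members of the chain $\{0\}\subsetneq V(\theta)\subsetneq V$. (b) If $\dim V$ is odd, then $V(\theta)$ has a unique irreducible $\triangle_q$-submodule $V(\theta)'$ of codimension $1$ in $V(\theta)$, and the $\triangle_q$-submodules of $V$ are exactly the members of the chain $\{0\}\subsetneq V(\theta)'\subsetneq V(\theta)\subsetneq V$. (ii) Suppose that $t_0$ is diagonalizable on $V$. Then $t_0$ has at most two eigenvalues in $V$. Moreover: (a) If $t_0$ has exactly one eigenvalue in $V$, then the $\triangle_q$-module $V$ is irreducible and $\dim V\le 2$. (b) If $t_0$ has exactly two eigenvalues in $V$, then there is a nonzero scalar $\theta\in\mathbb F\setminus\{\pm1\}$ such that these eigenvalues are $\theta$ and $\theta^{-1}$, and the $\triangle_q$-submodules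 of $V$ are exactly $\{0\}$, $V(\theta)$, $V(\theta^{-1})$, $V$; both $V(\theta)$ and $V(\theta^{-1})$ are nonzero and proper, and $V=V(\theta)\oplus V(\theta^{-1})$, so the submodule lattice is a diamond. -/

import Mathlib

namespace AskeyWilson

/-! ### Identities behind the homomorphism from the Askey--Wilson algebra to the DAHA -/

section Identities

variable {K R : Type*} [CommRing K] [Ring R] [Algebra K R]

theorem three_relations (a b c a' b' c' : R) (c0 c1 c2 c3 q qi : K) (hq : q * qi = 1)
    (ha : a' = c0 • 1 - a) (hb : b' = c1 • 1 - b) (hc : c' = c2 • 1 - c)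
    (haa : a * a = c0 • a - 1) (hbb : b * b = c1 • b - 1) (hcc : c * c = c2 • c - 1)
    (h0 : q • (a * b * c) + qi • (c' * b' * a') = c3 • 1)
    (h1 : q • (b * c * a) + qi • (a' * c' * b') = c3 • 1)
    (h2 : q • (c * a * b) + qi • (b' * a' * c') = c3 • 1) :
    (q • ((q • (b * c) + qi • (c' * b')) * (c * a + a' * c'))
        - qi • ((c * a + a' * c') * (q • (b * c) + qi • (c' * b')))
        + (q ^ 2 - qi ^ 2) • (b * a + a' * b')
        = (q - qi) • ((c3 * c2) • 1 + c1 • (q • a' + qi • a))) ∧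
    (q • ((c * a + a' * c') * (b * a + a' * b'))
        - qi • ((b * a + a' * b') * (c * a + a' * c'))
        + (q ^ 2 - qi ^ 2) • (q • (b * c) + qi • (c' * b'))
        = (q - qi) • ((c2 * c1) • 1 + c3 • (q • a' + qi • a))) ∧
    (q • ((b * a + a' * b') * (q • (b * c) + qi • (c' * b')))
        - qi • ((q • (b * c) + qi • (c' * b')) * (b * a + a' * b'))
        + (q ^ 2 - qi ^ 2) • (c * a + a' * c')
        = (q - qi) • ((c1 * c3) • 1 + c2 • (q • a' + qi • a))) := by
  subst ha hb hc
  have haa' : ∀ x, a * (a * x) = c0 • (a * x) - x := fun x => by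
    rw [← mul_assoc, haa, sub_mul, smul_mul_assoc, one_mul]
  have hbb' : ∀ x, b * (b * x) = c1 • (b * x) - x := fun x => by
    rw [← mul_assoc, hbb, sub_mul, smul_mul_assoc, one_mul]
  have hcc' : ∀ x, c * (c * x) = c2 • (c * x) - x := fun x => by
    rw [← mul_assoc, hcc, sub_mul, smul_mul_assoc, one_mul]
  have e1 := congrArg (· * c) h1
  have e2 := congrArg ((c2 • 1 - c) * ·) h1
  have e3 := congrArg (· * (c2 • 1 - c)) h0
  have e4 := congrArg (c * ·) h0
  have f1 := congrArg (· * (c0 • 1 - a)) h1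
  have f2 := congrArg (· * a) h0
  have f3 := congrArg (· * a) h2
  have f4 := congrArg (a * ·) h2
  have g1 := congrArg (b * ·) h0
  have g2 := congrArg (· * (c1 • 1 - b)) h0
  have g3 := congrArg ((c1 • 1 - b) * ·) h1
  have g4 := congrArg (· * b) h1
  clear h0 h1
  simp only [mul_sub, sub_mul, mul_add, add_mul, smul_mul_assoc, mul_smul_comm, mul_one, one_mul,
    mul_assoc, haa, hbb, hcc, haa', hbb', hcc', smul_sub, smul_add, smul_smul] at *
  refine ⟨?_, ?_, ?_⟩
  · linear_combination (norm := skip) q • e1 - qi • e2 + q • e3 - qi • e4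
    clear * - hq
    match_scalars <;> grind
  · linear_combination (norm := skip) q ^ 2 • f1 - qi ^ 2 • f2 + f3 + f4 - c0 • h2
    clear * - hq
    match_scalars <;> grind
  · linear_combination (norm := skip) q • g1 - qi • g2 + q • g3 - qi • g4
    clear * - hq
    match_scalars <;> grind

end Identities

/-! ### The parameter, the algebras and the homomorphism between them -/

section Algebras

variable {F : Type*} [Field F]

/-- `q` is nonzero and not a root of unity. -/
structure IsGeneric (q : F) : Prop where
  ne_zero : q ≠ 0
  pow_ne_one : ∀ n : ℕ, 0 < n → q ^ n ≠ 1

/-- The element `x + (q y z - q⁻¹ z y) / (q² - q⁻²)` of an `F`-algebra. -/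
def awExpr (q : F) {R : Type*} [Ring R] [Algebra F R] (x y z : R) : R :=
  x + (q ^ 2 - q⁻¹ ^ 2)⁻¹ • (q • (y * z) - q⁻¹ • (z * y))

theorem map_awExpr (q : F) {R S : Type*} [Ring R] [Algebra F R] [Ring S] [Algebra F S]
    (f : R →ₐ[F] S) (x y z : R) : f (awExpr q x y z) = awExpr q (f x) (f y) (f z) := by
  simp [awExpr]

/-- Generators of the universal Askey--Wilson algebra. -/
inductive AWGen
  | A
  | B
  | C

open FreeAlgebra in
/-- Defining relations of the universal Askey--Wilson algebra: each of
`A + (qBC - q⁻¹CB)/(q² - q⁻²)`, `B + (qCA - q⁻¹AC)/(q² - q⁻²)`, `C + (qAB - q⁻¹BA)/(q² - q⁻²)`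
commutes with the generators. -/
inductive AWRel (q : F) : FreeAlgebra F AWGen → FreeAlgebra F AWGen → Prop
  | alpha (g : AWGen) :
      AWRel q (awExpr q (ι F AWGen.A) (ι F AWGen.B) (ι F AWGen.C) * ι F g)
        (ι F g * awExpr q (ι F AWGen.A) (ι F AWGen.B) (ι F AWGen.C))
  | beta (g : AWGen) :
      AWRel q (awExpr q (ι F AWGen.B) (ι F AWGen.C) (ι F AWGen.A) * ι F g)
        (ι F g * awExpr q (ι F AWGen.B) (ι F AWGen.C) (ι F AWGen.A))
  | gamma (g : AWGen) :
      AWRel q (awExpr q (ι F AWGen.C) (ι F AWGen.A) (ι F AWGen.B) * ι F g)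
        (ι F g * awExpr q (ι F AWGen.C) (ι F AWGen.A) (ι F AWGen.B))

/-- The universal Askey--Wilson algebra `△_q`. -/
abbrev AW (q : F) : Type _ := RingQuot (AWRel q)

/-- The class of a generator in `△_q`. -/
noncomputable def AW.gen (q : F) (g : AWGen) : AW q :=
  RingQuot.mkAlgHom F (AWRel q) (FreeAlgebra.ι F g)

/-- Generators `t i` and `tInv i` (`i = 0, 1, 2, 3`) of the universal DAHA. -/
inductive DAHAGen
  | t (i : Fin 4)
  | tInv (i : Fin 4)

open FreeAlgebra in
/-- Defining relations of the universal DAHA of type `(C₁^∨, C₁)`. -/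
inductive DAHARel (q : F) : FreeAlgebra F DAHAGen → FreeAlgebra F DAHAGen → Prop
  | mul_inv (i : Fin 4) : DAHARel q (ι F (DAHAGen.t i) * ι F (DAHAGen.tInv i)) 1
  | inv_mul (i : Fin 4) : DAHARel q (ι F (DAHAGen.tInv i) * ι F (DAHAGen.t i)) 1
  | central (i : Fin 4) (g : DAHAGen) :
      DAHARel q ((ι F (DAHAGen.t i) + ι F (DAHAGen.tInv i)) * ι F g)
        (ι F g * (ι F (DAHAGen.t i) + ι F (DAHAGen.tInv i)))
  | prod : DAHARel q
      (ι F (DAHAGen.t 0) * ι F (DAHAGen.t 1) * ι F (DAHAGen.t 2) * ι F (DAHAGen.t 3))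
      (algebraMap F _ q⁻¹)

/-- The universal DAHA `ℌ_q` of type `(C₁^∨, C₁)`. -/
abbrev DAHA (q : F) : Type _ := RingQuot (DAHARel q)

/-- The invertible element `t_i` of `ℌ_q`. -/
noncomputable def DAHA.t (q : F) (i : Fin 4) : (DAHA q)ˣ where
  val := RingQuot.mkAlgHom F (DAHARel q) (FreeAlgebra.ι F (DAHAGen.t i))
  inv := RingQuot.mkAlgHom F (DAHARel q) (FreeAlgebra.ι F (DAHAGen.tInv i))
  val_inv := by
    rw [← map_mul, RingQuot.mkAlgHom_rel F (DAHARel.mul_inv i), map_one]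
  inv_val := by
    rw [← map_mul, RingQuot.mkAlgHom_rel F (DAHARel.inv_mul i), map_one]

theorem DAHA.induction {q : F} {P : DAHA q → Prop}
    (hF : ∀ r : F, P (algebraMap F (DAHA q) r))
    (ht : ∀ i, P (DAHA.t q i)) (htInv : ∀ i, P ((DAHA.t q i)⁻¹ : (DAHA q)ˣ))
    (hadd : ∀ x y, P x → P y → P (x + y)) (hmul : ∀ x y, P x → P y → P (x * y))
    (x : DAHA q) : P x := by
  obtain ⟨x, rfl⟩ := RingQuot.mkAlgHom_surjective F (DAHARel q) x
  induction x using FreeAlgebra.induction with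
  | grade0 r => rw [AlgHom.commutes]; exact hF r
  | grade1 g =>
    cases g with
    | t i => exact ht i
    | tInv i => exact htInv i
  | mul x y hx hy => rw [map_mul]; exact hmul _ _ hx hy
  | add x y hx hy => rw [map_add]; exact hadd _ _ hx hy

theorem AW.induction {q : F} {P : AW q → Prop}
    (hF : ∀ r : F, P (algebraMap F (AW q) r)) (hg : ∀ g, P (AW.gen q g))
    (hadd : ∀ x y, P x → P y → P (x + y)) (hmul : ∀ x y, P x → P y → P (x * y))
    (x : AW q) : P x := by
  obtain ⟨x, rfl⟩ := RingQuot.mkAlgHom_surjective F (AWRel q) x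
  induction x using FreeAlgebra.induction with
  | grade0 r => rw [AlgHom.commutes]; exact hF r
  | grade1 g => exact hg g
  | mul x y hx hy => rw [map_mul]; exact hmul _ _ hx hy
  | add x y hx hy => rw [map_add]; exact hadd _ _ hx hy

theorem DAHA.central (q : F) (i : Fin 4) (x : DAHA q) :
    Commute ((DAHA.t q i : DAHA q) + ((DAHA.t q i)⁻¹ : (DAHA q)ˣ)) x := by
  have key : ∀ g : DAHAGen,
      Commute ((DAHA.t q i : DAHA q) + ((DAHA.t q i)⁻¹ : (DAHA q)ˣ))
        (RingQuot.mkAlgHom F (DAHARel q) (FreeAlgebra.ι F g)) := fun g => by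
    have h := RingQuot.mkAlgHom_rel F (DAHARel.central (q := q) i g)
    simp only [map_mul, map_add] at h
    exact h
  induction x using DAHA.induction with
  | hF r => exact (Algebra.commutes r _).symm
  | ht j => exact key (DAHAGen.t j)
  | htInv j => exact key (DAHAGen.tInv j)
  | hadd x y hx hy => exact hx.add_right hy
  | hmul x y hx hy => exact hx.mul_right hy

theorem DAHA.prod (q : F) :
    (DAHA.t q 0 : DAHA q) * DAHA.t q 1 * DAHA.t q 2 * DAHA.t q 3 = algebraMap F _ q⁻¹ := by
  have h := RingQuot.mkAlgHom_rel F (DAHARel.prod (q := q))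
  simp only [map_mul, AlgHom.commutes] at h
  exact h

/-- `t_i t_0 + (t_i t_0)⁻¹`. -/
noncomputable def DAHA.sym (q : F) (i : Fin 4) : DAHA q :=
  ((DAHA.t q i * DAHA.t q 0 : (DAHA q)ˣ) : DAHA q) +
    ((DAHA.t q i * DAHA.t q 0)⁻¹ : (DAHA q)ˣ)

theorem DAHA.t_zero_commute_sym (q : F) (i : Fin 4) :
    Commute (DAHA.t q 0 : DAHA q) (DAHA.sym q i) := by
  have h0 := fun x => (DAHA.central q 0 x).eq
  have h1 := fun x => (DAHA.central q i x).eq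
  simp only [DAHA.sym, mul_inv_rev, Units.val_mul]
  generalize hb : DAHA.t q i = b at *
  generalize ha : DAHA.t q 0 = a at *
  have k1 := h1 a
  have k2 := h0 b
  have e : (b : DAHA q) * a + (a⁻¹ : (DAHA q)ˣ) * (b⁻¹ : (DAHA q)ˣ)
      = a * b + (b⁻¹ : (DAHA q)ˣ) * (a⁻¹ : (DAHA q)ˣ) := by
    have k3 := h0 (b⁻¹ : (DAHA q)ˣ)
    simp only [add_mul, mul_add] at k1 k2 k3
    linear_combination (norm := abel) k3 + k1
  have e' := congrArg ((a : DAHA q) * ·) e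
  have e'' : (a : DAHA q) * (b * a + (a⁻¹ : (DAHA q)ˣ) * (b⁻¹ : (DAHA q)ˣ))
     = (a * b + (b⁻¹ : (DAHA q)ˣ) * (a⁻¹ : (DAHA q)ˣ)) * a := by
    simp [mul_add, add_mul, mul_assoc]
  show _ = _
  rw [e'', e]

theorem DAHA.t_three (q : F) (hq : q ≠ 0) :
    (DAHA.t q 3 : DAHA q) = q⁻¹ • (((DAHA.t q 2)⁻¹ : (DAHA q)ˣ) *
      ((DAHA.t q 1)⁻¹ : (DAHA q)ˣ) * ((DAHA.t q 0)⁻¹ : (DAHA q)ˣ)) ∧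
    (((DAHA.t q 3)⁻¹ : (DAHA q)ˣ) : DAHA q) =
      q • ((DAHA.t q 0 : DAHA q) * DAHA.t q 1 * DAHA.t q 2) := by
  have h := DAHA.prod q
  generalize DAHA.t q 0 = a at *
  generalize DAHA.t q 1 = b at *
  generalize DAHA.t q 2 = c at *
  generalize DAHA.t q 3 = d at *
  rw [Algebra.algebraMap_eq_smul_one] at h
  constructor
  · have h' := congrArg
      (((c⁻¹ : (DAHA q)ˣ) * (b⁻¹ : (DAHA q)ˣ) * (a⁻¹ : (DAHA q)ˣ) : DAHA q) * ·) h
    simpa [mul_assoc] using h'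
  · have h' := congrArg (fun x => q • (x * ((d⁻¹ : (DAHA q)ˣ) : DAHA q))) h
    simp only [smul_mul_assoc, one_mul, smul_smul, mul_inv_cancel₀ hq, one_smul,
      Units.mul_inv_cancel_right] at h'
    exact h'.symm

/-- In any `F`-algebra with units satisfying the relations of `ℌ_q`, the images of `α/(q+q⁻¹)`,
`β/(q+q⁻¹)`, `γ/(q+q⁻¹)` are combinations of `1` and `t₀` with central coefficients. -/
theorem awExpr_combination {q : F} (hq : IsGeneric q) {R : Type*} [Ring R] [Algebra F R]
    (t : Fin 4 → Rˣ) (hcen : ∀ i x, Commute ((t i : R) + ((t i)⁻¹ : Rˣ)) x)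
    (d1 : (t 3 : R) = q⁻¹ • (((t 2)⁻¹ : Rˣ) * ((t 1)⁻¹ : Rˣ) * ((t 0)⁻¹ : Rˣ)))
    (d2 : (((t 3)⁻¹ : Rˣ) : R) = q • ((t 0 : R) * t 1 * t 2)) (y : Fin 4 → R)
    (hy : ∀ i, y i = (t i : R) * t 0 + ((t 0)⁻¹ : Rˣ) * ((t i)⁻¹ : Rˣ)) :
    ∃ z w : Fin 3 → Subring.center R,
      awExpr q (y 1) (y 3) (y 2) = z 0 • (1 : R) + w 0 • (t 0 : R) ∧
      awExpr q (y 3) (y 2) (y 1) = z 1 • (1 : R) + w 1 • (t 0 : R) ∧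
      awExpr q (y 2) (y 1) (y 3) = z 2 • (1 : R) + w 2 • (t 0 : R) := by
  have hq0 := hq.ne_zero
  obtain ⟨s, hs⟩ : ∃ s : Fin 4 → Subring.center R,
      ∀ i, s i • (1 : R) = (t i : R) + ((t i)⁻¹ : Rˣ) :=
    ⟨fun i => ⟨(t i : R) + ((t i)⁻¹ : Rˣ), by
      rw [Subring.mem_center_iff]
      exact fun x => ((hcen i x).eq).symm⟩, fun i => by
        rw [Subring.smul_def, smul_eq_mul, mul_one]⟩
  have hinv : ∀ i, (((t i)⁻¹ : Rˣ) : R) = s i • (1 : R) - t i :=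
    fun i => by rw [hs, add_sub_cancel_left]
  have hsq : ∀ i, (t i : R) * t i = s i • (t i : R) - 1 := fun i => by
    have : s i • (t i : R) = (s i • (1 : R)) * t i := by rw [smul_mul_assoc, one_mul]
    rw [this, hs, add_mul, Units.inv_mul, add_sub_cancel_right]
  obtain ⟨φ, hφ⟩ : ∃ φ : F →+* Subring.center R, ∀ (r : F) (x : R), φ r • x = r • x :=
    ⟨(algebraMap F R).codRestrict (Subring.center R) (fun r => by
      rw [Subring.mem_center_iff]
      exact fun x => (Algebra.commutes r x).symm), fun r x => by
        rw [Subring.smul_def, Algebra.smul_def]; rfl⟩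
  have hQ : φ q * φ q⁻¹ = 1 := by rw [← map_mul, mul_inv_cancel₀ hq0, map_one]
  have h0 : φ q • ((t 0 : R) * t 1 * t 2) +
      φ q⁻¹ • (((t 2)⁻¹ : Rˣ) * ((t 1)⁻¹ : Rˣ) * ((t 0)⁻¹ : Rˣ) : R) = s 3 • (1 : R) := by
    rw [hφ, hφ, hs, d1, d2, add_comm]
  have conj : ∀ (u : Rˣ) (x : R), x = s 3 • (1 : R) →
      (u⁻¹ : Rˣ) * x * u = s 3 • (1 : R) := fun u x hx => by
    rw [hx, mul_smul_comm, smul_mul_assoc, mul_one, Units.inv_mul]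
  have h1 := conj (t 0) _ h0
  simp only [mul_add, add_mul, mul_smul_comm, smul_mul_assoc, mul_assoc, Units.inv_mul,
    Units.inv_mul_cancel_left, mul_one] at h1
  have h2 := conj (t 1) _ h1
  simp only [mul_add, add_mul, mul_smul_comm, smul_mul_assoc, mul_assoc, Units.inv_mul,
    Units.inv_mul_cancel_left, mul_one] at h2
  have r := three_relations (K := Subring.center R) _ _ _ _ _ _ (s 0) (s 1) (s 2) (s 3)
    (φ q) (φ q⁻¹) hQ (hinv 0) (hinv 1) (hinv 2) (hsq 0) (hsq 1) (hsq 2) h0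
    (by simpa only [mul_assoc] using h1) (by simpa only [mul_assoc] using h2)
  have e3 : y 3 = φ q • ((t 1 : R) * t 2) +
      φ q⁻¹ • (((t 2)⁻¹ : Rˣ) * ((t 1)⁻¹ : Rˣ) : R) := by
    rw [hy, d1, d2, hφ, hφ, add_comm]
    simp only [mul_smul_comm, smul_mul_assoc, mul_assoc, Units.inv_mul,
      Units.inv_mul_cancel_left, mul_one]
  rw [← hy 1, ← hy 2, ← e3] at r
  have hne : q ^ 2 - q⁻¹ ^ 2 ≠ 0 := fun h => by
    apply hq.pow_ne_one 4 (by norm_num)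
    field_simp at h
    linear_combination h
  have fin : ∀ (x y z : R) (u v : Subring.center R),
      φ q • (y * z) - φ q⁻¹ • (z * y) + (φ q ^ 2 - φ q⁻¹ ^ 2) • x =
        (φ q - φ q⁻¹) • (u • (1 : R) + v • (φ q • (((t 0)⁻¹ : Rˣ) : R) +
          φ q⁻¹ • (t 0 : R))) →
      ∃ z₁ z₂ : Subring.center R, awExpr q x y z = z₁ • (1 : R) + z₂ • (t 0 : R) := by
    intro x y z u v hx
    have hx' : awExpr q x y z = φ (q ^ 2 - q⁻¹ ^ 2)⁻¹ • ((φ q - φ q⁻¹) • (u • (1 : R) +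
        v • (φ q • (((t 0)⁻¹ : Rˣ) : R) + φ q⁻¹ • (t 0 : R)))) := by
      rw [← hx, ← map_pow, ← map_pow, ← map_sub, hφ, hφ, hφ, hφ, smul_add, inv_smul_smul₀ hne,
        awExpr, add_comm]
    rw [hinv] at hx'
    refine ⟨φ (q ^ 2 - q⁻¹ ^ 2)⁻¹ * (φ q - φ q⁻¹) * (u + v * φ q * s 0),
      φ (q ^ 2 - q⁻¹ ^ 2)⁻¹ * (φ q - φ q⁻¹) * v * (φ q⁻¹ - φ q), ?_⟩
    rw [hx']
    module
  obtain ⟨z0, w0, k0⟩ := fin _ _ _ _ _ r.1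
  obtain ⟨z1, w1, k1⟩ := fin _ _ _ _ _ r.2.1
  obtain ⟨z2, w2, k2⟩ := fin _ _ _ _ _ r.2.2
  exact ⟨![z0, z1, z2], ![w0, w1, w2], k0, k1, k2⟩

/-- Images of the generators of `△_q` in `ℌ_q`. -/
noncomputable def zetaGen (q : F) : AWGen → DAHA q
  | AWGen.A => ((DAHA.t q 1 * DAHA.t q 0 : (DAHA q)ˣ) : DAHA q) +
      ((DAHA.t q 1 * DAHA.t q 0)⁻¹ : (DAHA q)ˣ)
  | AWGen.B => ((DAHA.t q 3 * DAHA.t q 0 : (DAHA q)ˣ) : DAHA q) +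
      ((DAHA.t q 3 * DAHA.t q 0)⁻¹ : (DAHA q)ˣ)
  | AWGen.C => ((DAHA.t q 2 * DAHA.t q 0 : (DAHA q)ˣ) : DAHA q) +
      ((DAHA.t q 2 * DAHA.t q 0)⁻¹ : (DAHA q)ˣ)

theorem t_zero_commute_zetaGen (q : F) (g : AWGen) :
    Commute (DAHA.t q 0 : DAHA q) (zetaGen q g) := by
  cases g <;> exact DAHA.t_zero_commute_sym q _

theorem zetaGen_rel {q : F} (hq : IsGeneric q) (x y : FreeAlgebra F AWGen) (h : AWRel q x y) :
    FreeAlgebra.lift F (zetaGen q) x = FreeAlgebra.lift F (zetaGen q) y := by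
  obtain ⟨z, w, e0, e1, e2⟩ := awExpr_combination hq (DAHA.t q) (DAHA.central q)
    (DAHA.t_three q hq.ne_zero).1 (DAHA.t_three q hq.ne_zero).2 (DAHA.sym q)
    (fun i => by simp only [DAHA.sym, mul_inv_rev, Units.val_mul])
  have key : ∀ (x : DAHA q) (u v : Subring.center (DAHA q)) (g : AWGen),
      x = u • (1 : DAHA q) + v • (DAHA.t q 0 : DAHA q) → x * zetaGen q g = zetaGen q g * x := by
    intro x u v g e
    rw [e, add_mul, mul_add, smul_mul_assoc, smul_mul_assoc, mul_smul_comm, mul_smul_comm,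
      one_mul, mul_one, (t_zero_commute_zetaGen q g).eq]
  cases h with
  | alpha g =>
    simp only [map_mul, map_awExpr, FreeAlgebra.lift_ι_apply]
    exact key _ _ _ g e0
  | beta g =>
    simp only [map_mul, map_awExpr, FreeAlgebra.lift_ι_apply]
    exact key _ _ _ g e1
  | gamma g =>
    simp only [map_mul, map_awExpr, FreeAlgebra.lift_ι_apply]
    exact key _ _ _ g e2

/-- The homomorphism `ζ : △_q → ℌ_q` with `A ↦ t₁t₀ + (t₁t₀)⁻¹`, `B ↦ t₃t₀ + (t₃t₀)⁻¹`,
`C ↦ t₂t₀ + (t₂t₀)⁻¹`. -/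
noncomputable def zeta {q : F} (hq : IsGeneric q) : AW q →ₐ[F] DAHA q :=
  RingQuot.liftAlgHom F ⟨FreeAlgebra.lift F (zetaGen q), zetaGen_rel hq⟩

theorem zeta_gen {q : F} (hq : IsGeneric q) (g : AWGen) :
    zeta hq (AW.gen q g) = zetaGen q g := by
  simp [zeta, AW.gen]

theorem t_zero_commute_zeta {q : F} (hq : IsGeneric q) (x : AW q) :
    Commute (DAHA.t q 0 : DAHA q) (zeta hq x) := by
  induction x using AW.induction with
  | hF r => rw [AlgHom.commutes]; exact (Algebra.commutes r _).symm
  | hg g => rw [zeta_gen]; exact t_zero_commute_zetaGen q g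
  | hadd x y hx hy => rw [map_add]; exact hx.add_right hy
  | hmul x y hx hy => rw [map_mul]; exact hx.mul_right hy

end Algebras

/-! ### `ℌ_q`-modules as `△_q`-modules -/

section Modules

variable {F : Type*} [Field F] {q : F}

/-- The `ℌ_q`-module `V` viewed as a `△_q`-module by pulling back via `ζ`. -/
def Pullback (_hq : IsGeneric q) (V : Type*) : Type _ := V

variable (hq : IsGeneric q) (V : Type*) [AddCommGroup V] [Module F V] [Module (DAHA q) V]

instance : AddCommGroup (Pullback hq V) := inferInstanceAs (AddCommGroup V)

instance : Module F (Pullback hq V) := inferInstanceAs (Module F V)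

noncomputable instance : Module (AW q) (Pullback hq V) :=
  Module.compHom V (zeta hq : AW q →+* DAHA q)

/-- The identity map from `V` to its pullback. -/
def Pullback.of : V ≃ₗ[F] Pullback hq V := LinearEquiv.refl F V

variable {V}

theorem Pullback.smul_of (x : AW q) (v : V) :
    x • Pullback.of hq V v = Pullback.of hq V (zeta hq x • v) := rfl

variable [IsScalarTower F (DAHA q) V]

instance : IsScalarTower F (AW q) (Pullback hq V) where
  smul_assoc r x v := by
    obtain ⟨v, rfl⟩ := (Pullback.of hq V).surjective v
    rw [Pullback.smul_of, Pullback.smul_of, AlgHom.map_smul_of_tower, smul_assoc,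
      LinearEquiv.map_smul]

variable (q V) in
/-- The action of `t₀` on the `ℌ_q`-module `V`. -/
noncomputable def t0End : Module.End F V :=
  Algebra.lsmul F F V (DAHA.t q 0 : DAHA q)

variable (V) in
/-- The null space `V(θ)` of `t₀ - θ` in `V`, as a `△_q`-submodule. -/
noncomputable def t0Eigenspace (θ : F) : Submodule (AW q) (Pullback hq V) where
  carrier := {w | (DAHA.t q 0 : DAHA q) • (Pullback.of hq V).symm w =
    θ • (Pullback.of hq V).symm w}
  zero_mem' := by simp
  add_mem' := by
    intro v w hv hw
    simp only [Set.mem_ofPred_eq] at hv hw ⊢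
    rw [map_add, smul_add, smul_add, hv, hw]
  smul_mem' := by
    intro x v hv
    obtain ⟨v, rfl⟩ := (Pullback.of hq V).surjective v
    simp only [Set.mem_ofPred_eq, LinearEquiv.symm_apply_apply, Pullback.smul_of] at hv ⊢
    rw [← mul_smul, (t_zero_commute_zeta hq x).eq, mul_smul, hv, smul_comm]

/-- An endomorphism of a vector space is diagonalizable if its eigenvectors span the space. -/
def IsDiagonalizable {W : Type*} [AddCommGroup W] [Module F W] (f : Module.End F W) : Prop :=
  (⨆ μ : F, f.eigenspace μ) = ⊤

end Modules

end AskeyWilson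

/-!
By Schur's lemma each `t_i + t_i⁻¹` acts on `V` as a scalar `c_i`, and the `△_q`-submodules of `V`
are the subspaces stable under the three operators `t_i t₀ + (t_i t₀)⁻¹`. If such a subspace `W`
is also `t₀`-stable, then `W + ∑ t_i W` and `{v ∈ W : t_i v ∈ W for all i}` are `ℌ_q`-stable; hence
the former is `V` when `W ≠ 0` and the latter is `0` when `W ≠ V`. So a nonzero `W ⊆ V(θ)` contains
`(t₀ - θ⁻¹) V`, and dually a proper `W` containing `(t₀ - θ) V` lies in `V(θ⁻¹)`.

The Askey–Wilson relations force `W` to be `t₀`-stable unless `c₁ = c₂ = c₃ = 0`. In that case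
`t_i² = -1` for `i ≠ 0`, so `det t_i` has finite order, whereas `det (t₀ t₁ t₂ t₃) = q ^ (-dim V)`
has not; this is impossible when `det t₀` has finite order, in particular when the only eigenvalue
of `t₀` is `1` or `-1`. If `θ ≠ θ⁻¹`, a nonzero `W` meeting neither `V(θ)` nor `V(θ⁻¹)` would be a
common complement of the two, which forces `det t₀ = 1`.

A common eigenvector of `t₀` and `t_i`, moved alternately by `t₂` and `t₀`, spans a flag on which
`t₀ t_i` is triangular with explicit eigenvalues. The resulting formula for `det t₀ * det t_i`
bounds `dim V(±1)`.
-/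

namespace AskeyWilson

section Tuples

open MulOpposite

variable {F R : Type*} [Field F] [Ring R] [Algebra F R]

/-- The relations of `ℌ_q` for the images `t i` of the generators in an `F`-algebra in which each
`t_i + t_i⁻¹` is the scalar `c i`; the inverse of `t i` is then `tInv t c i`. -/
structure IsDAHATuple (q : F) (t : Fin 4 → R) (c : Fin 4 → F) : Prop where
  mul_self : ∀ i, t i * t i = c i • t i - 1
  prod : t 0 * t 1 * t 2 * t 3 = q⁻¹ • 1

/-- The element `c_i - t_i`, which is the inverse of `t_i` when `t_i + t_i⁻¹ = c_i`. -/
def tInv (t : Fin 4 → R) (c : Fin 4 → F) (i : Fin 4) : R := c i • 1 - t i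

/-- The element `t_i t_0 + (t_i t_0)⁻¹`, written without inverses. -/
def sym (t : Fin 4 → R) (c : Fin 4 → F) (i : Fin 4) : R := t i * t 0 + tInv t c 0 * tInv t c i

theorem sym_eq (t : Fin 4 → R) (c : Fin 4 → F) (i : Fin 4) :
    sym t c i = t 0 * t i + tInv t c i * tInv t c 0 := by
  simp only [sym, tInv, sub_mul, mul_sub, smul_mul_assoc, mul_smul_comm, one_mul, mul_one]
  module

theorem mul_tInv_mem_iff {D : Submodule F R} {x : R} (hx : x ∈ D) (t : Fin 4 → R) (c : Fin 4 → F)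
    (i : Fin 4) : x * tInv t c i ∈ D ↔ x * t i ∈ D := by
  rw [tInv, mul_sub, mul_smul_comm, mul_one, D.sub_mem_iff_right (D.smul_mem _ hx)]

theorem tInv_mul_mem_iff {D : Submodule F R} {x : R} (hx : x ∈ D) (t : Fin 4 → R) (c : Fin 4 → F)
    (i : Fin 4) : tInv t c i * x ∈ D ↔ t i * x ∈ D := by
  rw [tInv, sub_mul, smul_mul_assoc, one_mul, D.sub_mem_iff_right (D.smul_mem _ hx)]

theorem sub_smul_mul_eq (t : Fin 4 → R) {c : Fin 4 → F} {θ θ' : F} (hc : θ + θ' = c 0)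
    (i : Fin 4) : (t 0 - θ' • 1) * t i =
      sym t c i - (c i * θ') • 1 + tInv t c i * (t 0 - θ • 1) := by
  simp only [sym_eq, tInv, ← hc, sub_mul, mul_sub, smul_mul_assoc, mul_smul_comm, one_mul, mul_one]
  module

theorem mul_sub_smul_eq (t : Fin 4 → R) {c : Fin 4 → F} {θ θ' : F} (hc : θ + θ' = c 0)
    (i : Fin 4) : t i * (t 0 - θ' • 1) =
      sym t c i - (c i * θ') • 1 + (t 0 - θ • 1) * tInv t c i := by
  simp only [sym, tInv, ← hc, sub_mul, mul_sub, smul_mul_assoc, mul_smul_comm, one_mul, mul_one]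
  module

namespace IsDAHATuple

variable {q : F} {t : Fin 4 → R} {c : Fin 4 → F}

section Relations

variable (H : IsDAHATuple q t c)
include H

theorem mul_tInv (i : Fin 4) : t i * tInv t c i = 1 := by
  simp [tInv, mul_sub, H.mul_self i]

theorem tInv_mul (i : Fin 4) : tInv t c i * t i = 1 := by
  simp [tInv, sub_mul, H.mul_self i]

theorem mul_tInv_cancel_left (i : Fin 4) (x : R) : t i * (tInv t c i * x) = x := by
  rw [← mul_assoc, H.mul_tInv, one_mul]

theorem tInv_mul_cancel_left (i : Fin 4) (x : R) : tInv t c i * (t i * x) = x := by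
  rw [← mul_assoc, H.tInv_mul, one_mul]

theorem mul_tInv_cancel_right (x : R) (i : Fin 4) : x * t i * tInv t c i = x := by
  rw [mul_assoc, H.mul_tInv, mul_one]

theorem tInv_mul_cancel_right (x : R) (i : Fin 4) : x * tInv t c i * t i = x := by
  rw [mul_assoc, H.tInv_mul, mul_one]

theorem rotate : IsDAHATuple q (fun i => t (i + 1)) (fun i => c (i + 1)) where
  mul_self i := H.mul_self _
  prod := by
    have h := congrArg (tInv t c 0 * · * t 0) H.prod
    simp only [mul_assoc, H.tInv_mul_cancel_left, mul_smul_comm, smul_mul_assoc, one_mul,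
      H.tInv_mul] at h
    simpa only [mul_assoc] using! h

theorem prod_cyclic (i : Fin 4) : t i * t (i + 1) * t (i + 2) * t (i + 3) = q⁻¹ • 1 := by
  fin_cases i
  exacts [H.prod, H.rotate.prod, H.rotate.rotate.prod, H.rotate.rotate.rotate.prod]

theorem mul_mul_eq (i : Fin 4) : t i * t (i + 1) * t (i + 2) = q⁻¹ • tInv t c (i + 3) := by
  have h := congrArg (· * tInv t c (i + 3)) (H.prod_cyclic i)
  simpa only [H.mul_tInv_cancel_right, smul_mul_assoc, one_mul] using h

theorem mul_eq (i : Fin 4) :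
    t i * t (i + 1) = q⁻¹ • (tInv t c (i + 3) * tInv t c (i + 2)) := by
  have h := congrArg (· * tInv t c (i + 2)) (H.mul_mul_eq i)
  simpa only [H.mul_tInv_cancel_right, smul_mul_assoc] using h

theorem tInv_mul_tInv_eq (hq : q ≠ 0) (i : Fin 4) :
    tInv t c (i + 3) * tInv t c (i + 2) = q • (t i * t (i + 1)) := by
  rw [H.mul_eq, smul_inv_smul₀ hq]

theorem tInv_mul_tInv_mul_tInv_eq (hq : q ≠ 0) (i : Fin 4) :
    tInv t c (i + 2) * tInv t c (i + 1) * tInv t c i = q • t (i + 3) := by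
  have h := congrArg (tInv t c (i + 2) * tInv t c (i + 1) * tInv t c i * ·) (H.prod_cyclic i)
  simp only [mul_assoc, H.tInv_mul_cancel_left, mul_smul_comm, mul_one] at h ⊢
  rw [h, smul_inv_smul₀ hq]

theorem commute_sym (i : Fin 4) : Commute (t 0) (sym t c i) := by
  have h : t 0 * sym t c i = (t 0 * t i + tInv t c i * tInv t c 0) * t 0 := by
    rw [sym, mul_add, H.mul_tInv_cancel_left, add_mul, H.tInv_mul_cancel_right, mul_assoc]
  rw [Commute, SemiconjBy, h, sym_eq]

theorem mul_sym_one_mul :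
    t 3 * sym t c 1 * t 0 = q⁻¹ • tInv t c 2 * t 0 + t 3 * tInv t c 1 := by
  rw [sym_eq, mul_add, ← mul_assoc, ← mul_assoc, add_mul, H.tInv_mul_cancel_right]
  exact congrArg (· * t 0 + _) (H.mul_mul_eq 3)

theorem tInv_mul_sym_three_mul (hq : q ≠ 0) :
    tInv t c 1 * sym t c 3 * tInv t c 0 = tInv t c 1 * t 3 + q • t 2 * tInv t c 0 := by
  rw [sym, mul_add, add_mul, ← mul_assoc, H.mul_tInv_cancel_right, ← mul_assoc]
  exact congrArg (_ + · * tInv t c 0) (H.tInv_mul_tInv_mul_tInv_eq hq 3)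

theorem braid : IsDAHATuple q ![t 0, t 2, tInv t c 2 * t 1 * t 2, t 3] ![c 0, c 2, c 1, c 3] where
  mul_self i := by
    fin_cases i
    · exact H.mul_self 0
    · exact H.mul_self 2
    · change tInv t c 2 * t 1 * t 2 * (tInv t c 2 * t 1 * t 2) =
        c 1 • (tInv t c 2 * t 1 * t 2) - 1
      simp only [mul_assoc, H.mul_tInv_cancel_left]
      rw [← mul_assoc (t 1) (t 1), H.mul_self 1, sub_mul, mul_sub, one_mul, H.tInv_mul,
        smul_mul_assoc, mul_smul_comm]
    · exact H.mul_self 3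
  prod := by
    simp only [Matrix.cons_val, mul_assoc, H.mul_tInv_cancel_left]
    simpa only [mul_assoc] using H.prod

theorem opposite : IsDAHATuple q (fun i => op (t (-i))) (fun i => c (-i)) where
  mul_self i := by rw [← op_mul, H.mul_self, op_sub, op_smul, op_one]
  prod := by
    have h := congrArg op (H.prod_cyclic 1)
    simpa only [op_mul, mul_assoc, op_smul, op_one] using! h

end Relations

theorem sym_op (t : Fin 4 → R) (c : Fin 4 → F) (i : Fin 4) :
    sym (fun j => op (t (-j))) (fun j => c (-j)) i = op (sym t c (-i)) := by
  rw [sym_eq t c]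
  simp [sym, tInv]

section DegreeTwo

variable {D : Submodule F R} (H : IsDAHATuple q t c) (hq : q ≠ 0)
include H hq

theorem mul_mem_of_mul_sym_mem (h1 : 1 ∈ D) (ht : ∀ i, t i ∈ D)
    (h0 : ∀ x ∈ D, x * t 0 ∈ D) (hS : ∀ i ≠ 0, ∀ x ∈ D, x * sym t c i ∈ D) (i j : Fin 4) :
    t i * t j ∈ D := by
  have hs (i) : tInv t c i ∈ D := D.sub_mem (D.smul_mem _ h1) (ht i)
  have hss (i j) : tInv t c i * tInv t c j ∈ D ↔ t i * t j ∈ D := by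
    rw [mul_tInv_mem_iff (hs i), tInv_mul_mem_iff (ht j)]
  have h0' {x} (hx : x ∈ D) : x * tInv t c 0 ∈ D := (mul_tInv_mem_iff hx t c 0).2 (h0 x hx)
  have self (i) : t i * t i ∈ D := by
    rw [H.mul_self]
    exact D.sub_mem (D.smul_mem _ (ht i)) h1
  have zero_mul (i) : t 0 * t i ∈ D := by
    obtain rfl | hi := eq_or_ne i 0
    · exact self 0
    · have h := hS i hi 1 h1
      rwa [one_mul, sym_eq, D.add_mem_iff_left (h0' (hs i))] at h
  have h12 : t 1 * t 2 ∈ D :=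
    H.mul_eq 1 ▸ D.smul_mem _ ((hss 0 3).2 (zero_mul 3))
  have h23 : t 2 * t 3 ∈ D :=
    H.mul_eq 2 ▸ D.smul_mem _ ((hss 1 0).2 (h0 _ (ht 1)))
  have h21 : t 2 * t 1 ∈ D :=
    (hss 2 1).1 (H.tInv_mul_tInv_eq hq 3 ▸ D.smul_mem _ (h0 _ (ht 3)))
  have h32 : t 3 * t 2 ∈ D :=
    (hss 3 2).1 (H.tInv_mul_tInv_eq hq 0 ▸ D.smul_mem _ (zero_mul 1))
  have h31 : t 3 * t 1 ∈ D := by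
    have h := h0 _ (hS 1 (by decide) _ (ht 3))
    rwa [H.mul_sym_one_mul, D.add_mem_iff_right (h0 _ (D.smul_mem _ (hs 2))),
      mul_tInv_mem_iff (ht 3)] at h
  have h13 : t 1 * t 3 ∈ D := by
    have h := h0' (hS 3 (by decide) _ (hs 1))
    rwa [H.tInv_mul_sym_three_mul hq, D.add_mem_iff_left (h0' (D.smul_mem _ (ht 2))),
      tInv_mul_mem_iff (ht 3)] at h
  fin_cases i <;> fin_cases j
  exacts [self 0, zero_mul 1, zero_mul 2, zero_mul 3, h0 _ (ht 1), self 1, h12, h13,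
    h0 _ (ht 2), h21, self 2, h23, h0 _ (ht 3), h31, h32, self 3]

theorem mul_mem_of_sym_mul_mem (h1 : 1 ∈ D) (ht : ∀ i, t i ∈ D)
    (h0 : ∀ x ∈ D, t 0 * x ∈ D) (hS : ∀ i ≠ 0, ∀ x ∈ D, sym t c i * x ∈ D) (i j : Fin 4) :
    t i * t j ∈ D := by
  let D' : Submodule F Rᵐᵒᵖ := D.comap (opLinearEquiv F).symm.toLinearMap
  have hS' (i) (hi : i ≠ 0) (x) (hx : x ∈ D') :
      x * sym (fun j => op (t (-j))) (fun j => c (-j)) i ∈ D' := by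
    rw [sym_op]
    exact hS (-i) (neg_ne_zero.2 hi) x.unop hx
  have h : op (t (- -j)) * op (t (- -i)) ∈ D' := H.opposite.mul_mem_of_mul_sym_mem hq h1
    (fun i => ht (-i)) (fun x hx => h0 x.unop hx) hS' (-j) (-i)
  rwa [neg_neg, neg_neg] at h

end DegreeTwo

end IsDAHATuple

end Tuples

section SymRelations

variable {F R : Type*} [Field F] [Ring R] [Algebra F R] {q : F} {t : Fin 4 → R} {c : Fin 4 → F}

theorem IsDAHATuple.exists_sym_relation (H : IsDAHATuple q t c) (hq : q ≠ 0) {i : Fin 4}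
    (hi : i ≠ 0) : ∃ j ≠ 0, ∃ k ≠ 0,
      q • (sym t c j * sym t c k) - q⁻¹ • (sym t c k * sym t c j) +
          (q ^ 2 - q⁻¹ ^ 2) • sym t c i =
        (q - q⁻¹) • ((c j * c k) • 1 + c i • (q • tInv t c 0 + q⁻¹ • t 0)) := by
  have e03 : tInv t c 0 * tInv t c 3 = q • (t 1 * t 2) := H.tInv_mul_tInv_eq hq 1
  have e32 : tInv t c 3 * tInv t c 2 = q • (t 0 * t 1) := H.tInv_mul_tInv_eq hq 0
  have e30 : t 3 * t 0 = q⁻¹ • (tInv t c 2 * tInv t c 1) := H.mul_eq 3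
  have e23 : t 2 * t 3 = q⁻¹ • (tInv t c 1 * tInv t c 0) := H.mul_eq 2
  have hsum : tInv t c 3 + t 3 = c 3 • 1 := sub_add_cancel _ _
  have h0 : q • (t 0 * t 1 * t 2) + q⁻¹ • (tInv t c 2 * tInv t c 1 * tInv t c 0) = c 3 • 1 := by
    rw [mul_assoc (t 0), ← mul_smul_comm, ← e03, H.mul_tInv_cancel_left, ← smul_mul_assoc, ← e30,
      H.mul_tInv_cancel_right, hsum]
  have h1 : q • (t 1 * t 2 * t 0) + q⁻¹ • (tInv t c 0 * tInv t c 2 * tInv t c 1) = c 3 • 1 := by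
    rw [← smul_mul_assoc, ← e03, mul_assoc, mul_assoc, ← mul_smul_comm, ← e30, ← mul_add,
      ← add_mul, hsum, smul_mul_assoc, one_mul, mul_smul_comm, H.tInv_mul]
  have h2 : q • (t 2 * t 0 * t 1) + q⁻¹ • (tInv t c 1 * tInv t c 0 * tInv t c 2) = c 3 • 1 := by
    rw [mul_assoc (t 2), ← mul_smul_comm, ← e32, ← smul_mul_assoc, ← e23, mul_assoc, ← mul_add,
      ← add_mul, hsum, smul_mul_assoc, one_mul, mul_smul_comm, H.mul_tInv]
  have hrel := three_relations (t 0) (t 1) (t 2) (tInv t c 0) (tInv t c 1) (tInv t c 2) (c 0) (c 1)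
    (c 2) (c 3) q q⁻¹ (mul_inv_cancel₀ hq) rfl rfl rfl (H.mul_self 0) (H.mul_self 1)
    (H.mul_self 2) h0 h1 h2
  have h3 : sym t c 3 = q • (t 1 * t 2) + q⁻¹ • (tInv t c 2 * tInv t c 1) := by
    rw [sym, e03, e30, add_comm]
  rw [← h3] at hrel
  obtain rfl | rfl | rfl : i = 1 ∨ i = 2 ∨ i = 3 := by lia
  exacts [⟨3, by decide, 2, by decide, hrel.1⟩, ⟨1, by decide, 3, by decide, hrel.2.2⟩,
    ⟨2, by decide, 1, by decide, hrel.2.1⟩]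

theorem IsGeneric.sub_inv_ne_zero (hq : IsGeneric q) : q - q⁻¹ ≠ 0 := fun h =>
  hq.pow_ne_one 2 two_pos <| by
    rw [pow_two]
    nth_rewrite 2 [sub_eq_zero.1 h]
    exact mul_inv_cancel₀ hq.ne_zero

theorem IsDAHATuple.t_zero_mem_adjoin (H : IsDAHATuple q t c) (hq : IsGeneric q) {i : Fin 4}
    (hi : i ≠ 0) (hci : c i ≠ 0) : t 0 ∈ Algebra.adjoin F (sym t c '' {0}ᶜ) := by
  set S := Algebra.adjoin F (sym t c '' {0}ᶜ)
  have hS {j : Fin 4} (hj : j ≠ 0) : sym t c j ∈ S := Algebra.subset_adjoin ⟨j, hj, rfl⟩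
  obtain ⟨j, hj, k, hk, e⟩ := H.exists_sym_relation hq.ne_zero hi
  have hmem : (q - q⁻¹) • ((c j * c k) • (1 : R) + c i • (q • tInv t c 0 + q⁻¹ • t 0)) ∈ S :=
    e ▸ S.add_mem (S.sub_mem (S.smul_mem (S.mul_mem (hS hj) (hS hk)) _)
      (S.smul_mem (S.mul_mem (hS hk) (hS hj)) _)) (S.smul_mem (hS hi) _)
  have hlin : (q - q⁻¹) • ((c j * c k) • (1 : R) + c i • (q • tInv t c 0 + q⁻¹ • t 0)) =
      ((q - q⁻¹) * (c j * c k + c i * q * c 0)) • 1 - ((q - q⁻¹) ^ 2 * c i) • t 0 := by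
    rw [tInv]
    module
  rw [hlin] at hmem
  have h0 := S.sub_mem (S.smul_mem S.one_mem ((q - q⁻¹) * (c j * c k + c i * q * c 0))) hmem
  rw [sub_sub_cancel] at h0
  exact (Submodule.smul_mem_iff (Subalgebra.toSubmodule S)
    (mul_ne_zero (pow_ne_zero 2 hq.sub_inv_ne_zero) hci)).1 h0

end SymRelations

section Operators

open Module Module.End

variable {F V : Type*} [Field F] [AddCommGroup V] [Module F V]

theorem mem_invtSubmodule_of_mem_adjoin {S : Set (End F V)} {W : Submodule F V}
    (hS : ∀ f ∈ S, W ∈ f.invtSubmodule) {f : End F V} (hf : f ∈ Algebra.adjoin F S) :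
    W ∈ f.invtSubmodule := by
  induction hf using Algebra.adjoin_induction with
  | mem f hf => exact hS f hf
  | algebraMap r => exact fun w hw => W.smul_mem r hw
  | add f g _ _ hf hg => exact invtSubmodule_inf_invtSubmodule_le_invtSubmodule_add f g ⟨hf, hg⟩
  | mul f g _ _ hf hg => exact invtSubmodule.comp f hf hg

/-- The operators `t i` have no common invariant subspace besides `⊥` and `⊤`. -/
def ActsIrreducibly {ι : Type*} (t : ι → End F V) : Prop :=
  ∀ W : Submodule F V, (∀ i, W ∈ (t i).invtSubmodule) → W = ⊥ ∨ W = ⊤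

theorem ActsIrreducibly.of_mem_adjoin {ι κ : Type*} {t : ι → End F V} {u : κ → End F V}
    (h : ActsIrreducibly t) (htu : ∀ i, t i ∈ Algebra.adjoin F (Set.range u)) :
    ActsIrreducibly u := fun W hW =>
  h W fun i => mem_invtSubmodule_of_mem_adjoin (Set.forall_mem_range.2 hW) (htu i)

/-- `W` is stable under the operators `t_i t_0 + (t_i t_0)⁻¹` for `i ≠ 0`, which are the images
of the generators of `△_q`. -/
def IsSymInvariant (t : Fin 4 → End F V) (c : Fin 4 → F) (W : Submodule F V) : Prop :=
  ∀ i ≠ 0, W ∈ (sym t c i).invtSubmodule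

variable {q : F} {t : Fin 4 → End F V} {c : Fin 4 → F} {W : Submodule F V}

theorem IsSymInvariant.inf {W' : Submodule F V} (hW : IsSymInvariant t c W)
    (hW' : IsSymInvariant t c W') : IsSymInvariant t c (W ⊓ W') := fun i hi =>
  invtSubmodule.inf_mem (hW i hi) (hW' i hi)

theorem IsSymInvariant.sup {W' : Submodule F V} (hW : IsSymInvariant t c W)
    (hW' : IsSymInvariant t c W') : IsSymInvariant t c (W ⊔ W') := fun i hi =>
  invtSubmodule.sup_mem (hW i hi) (hW' i hi)

namespace IsDAHATuple

variable (H : IsDAHATuple q t c)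
include H

theorem isSymInvariant_eigenspace (θ : F) : IsSymInvariant t c ((t 0).eigenspace θ) := by
  intro i _ w hw
  rw [Submodule.mem_comap, mem_eigenspace_iff, ← mul_apply, (H.commute_sym i).eq, mul_apply,
    mem_eigenspace_iff.1 hw, map_smul]

theorem isSymInvariant_range (θ : F) : IsSymInvariant t c (t 0 - θ • 1).range := by
  rintro i - _ ⟨v, rfl⟩
  refine ⟨sym t c i v, ?_⟩
  have e : (t 0 - θ • 1) * sym t c i = sym t c i * (t 0 - θ • 1) :=
    (H.commute_sym i).sub_left ((Commute.one_left _).smul_left θ)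
  exact LinearMap.congr_fun e v

theorem invtSubmodule_t_zero (hq : IsGeneric q) {i : Fin 4} (hi : i ≠ 0) (hci : c i ≠ 0)
    (hW : IsSymInvariant t c W) : W ∈ (t 0).invtSubmodule :=
  mem_invtSubmodule_of_mem_adjoin (by rintro _ ⟨j, hj, rfl⟩; exact hW j hj)
    (H.t_zero_mem_adjoin hq hi hci)

theorem sup_iSup_map_eq_top (hirr : ActsIrreducibly t) (hq : q ≠ 0)
    (h0 : W ∈ (t 0).invtSubmodule) (hW : IsSymInvariant t c W) (hbot : W ≠ ⊥) :
    W ⊔ ⨆ i, W.map (t i) = ⊤ := by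
  set M := W ⊔ ⨆ i, W.map (t i)
  have hWM : W ≤ M := le_sup_left
  have ht (i) : t i ∈ W.compatibleMaps M :=
    Submodule.map_le_iff_le_comap.1 ((le_iSup (fun i => W.map (t i)) i).trans le_sup_right)
  have hmul (i j) : t i * t j ∈ W.compatibleMaps M :=
    H.mul_mem_of_mul_sym_mem hq hWM ht (fun x hx w hw => hx (h0 hw))
      (fun i hi x hx w hw => hx (hW i hi hw)) i j
  have hM (i) : M ≤ M.comap (t i) :=
    sup_le (ht i) (iSup_le fun j => Submodule.map_le_iff_le_comap.2 (hmul i j))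
  exact (hirr M hM).resolve_left fun h => hbot (le_bot_iff.1 (h ▸ hWM))

theorem inf_iInf_comap_eq_bot (hirr : ActsIrreducibly t) (hq : q ≠ 0)
    (h0 : W ∈ (t 0).invtSubmodule) (hW : IsSymInvariant t c W) (htop : W ≠ ⊤) :
    W ⊓ ⨅ i, W.comap (t i) = ⊥ := by
  set N := W ⊓ ⨅ i, W.comap (t i)
  have hNW : N ≤ W := inf_le_left
  have ht (i) : t i ∈ N.compatibleMaps W :=
    inf_le_right.trans (iInf_le (fun i => W.comap (t i)) i)
  have hmul (i j) : t i * t j ∈ N.compatibleMaps W :=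
    H.mul_mem_of_sym_mul_mem hq hNW ht (fun x hx w hw => h0 (hx hw))
      (fun i hi x hx w hw => hW i hi (hx hw)) i j
  have hN (i) : N ≤ N.comap (t i) :=
    le_inf (ht i) ((Submodule.comap_iInf (t i) _).symm ▸ le_iInf fun j => hmul j i)
  exact (hirr N hN).resolve_right fun h => htop (top_le_iff.1 (h ▸ hNW))

theorem range_le_of_le_eigenspace (hirr : ActsIrreducibly t) (hq : q ≠ 0) {θ θ' : F}
    (hc : θ + θ' = c 0) (hW : IsSymInvariant t c W) (hbot : W ≠ ⊥)
    (hle : W ≤ (t 0).eigenspace θ) : (t 0 - θ' • 1).range ≤ W := by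
  have h0 : W ∈ (t 0).invtSubmodule := fun w hw =>
    (mem_eigenspace_iff.1 (hle hw) ▸ W.smul_mem θ hw : t 0 w ∈ W)
  have hker (w) (hw : w ∈ W) : (t 0 - θ • 1) w = 0 := sub_eq_zero.2 (mem_eigenspace_iff.1 (hle hw))
  rw [LinearMap.range_eq_map, ← H.sup_iSup_map_eq_top hirr hq h0 hW hbot, Submodule.map_sup,
    Submodule.map_iSup]
  refine sup_le ?_ (iSup_le fun i => ?_) <;> rw [Submodule.map_le_iff_le_comap]
  · exact fun w hw => W.sub_mem (h0 hw) (W.smul_mem θ' hw)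
  · rw [Submodule.map_le_iff_le_comap]
    intro w hw
    obtain rfl | hi := eq_or_ne i 0
    · exact W.sub_mem (h0 (h0 hw)) (W.smul_mem θ' (h0 hw))
    · have e := LinearMap.congr_fun (sub_smul_mul_eq t hc i) w
      rw [LinearMap.add_apply, mul_apply (tInv t c i), hker w hw, map_zero, add_zero] at e
      rw [Submodule.mem_comap, Submodule.mem_comap, ← mul_apply, e]
      exact W.sub_mem (hW i hi hw) (W.smul_mem _ hw)

theorem le_eigenspace_of_range_le (hirr : ActsIrreducibly t) (hq : q ≠ 0) {θ θ' : F}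
    (hc : θ + θ' = c 0) (hW : IsSymInvariant t c W) (htop : W ≠ ⊤)
    (hle : (t 0 - θ • 1).range ≤ W) : W ≤ (t 0).eigenspace θ' := by
  have h0 : W ∈ (t 0).invtSubmodule := fun w hw =>
    (Submodule.sub_mem_iff_left W (W.smul_mem θ hw)).1 (hle ⟨w, rfl⟩)
  intro w hw
  have hsub : (t 0 - θ' • 1) w ∈ W := W.sub_mem (h0 hw) (W.smul_mem θ' hw)
  rw [eigenspace_def, LinearMap.mem_ker, ← Submodule.mem_bot F,
    ← H.inf_iInf_comap_eq_bot hirr hq h0 hW htop]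
  refine ⟨hsub, Submodule.mem_iInf _ |>.2 fun i => ?_⟩
  obtain rfl | hi := eq_or_ne i 0
  · exact h0 hsub
  · have e := LinearMap.congr_fun (mul_sub_smul_eq t hc i) w
    rw [Submodule.mem_comap, ← mul_apply, e]
    exact W.add_mem (W.sub_mem (hW i hi hw) (W.smul_mem _ hw)) (hle ⟨_, rfl⟩)

end IsDAHATuple

end Operators

section Quadratic

open Module Module.End

variable {F V : Type*} [Field F] [AddCommGroup V] [Module F V]

theorem exists_mul_eq_one_add_eq [IsAlgClosed F] (c : F) : ∃ a b : F, a * b = 1 ∧ a + b = c := by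
  open Polynomial in
  have hdeg : (X ^ 2 - C c * X + 1 : F[X]).degree ≠ 0 := by
    have : (X ^ 2 - C c * X + 1 : F[X]).degree = 2 := by compute_degree!
    simp [this]
  obtain ⟨a, ha⟩ := IsAlgClosed.exists_root _ hdeg
  have ha' : a ^ 2 - c * a + 1 = 0 := by simpa using ha
  exact ⟨a, c - a, by linear_combination -ha', by ring⟩

theorem sub_smul_mul_sub_smul_eq_zero {R : Type*} [Ring R] [Algebra F R] {x : R} {a b c : F}
    (hx : x * x = c • x - 1) (hab : a * b = 1) (hc : a + b = c) :
    (x - a • 1) * (x - b • 1) = 0 := by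
  have e : (x - a • 1) * (x - b • 1) = x * x - (a + b) • x + (a * b) • 1 := by
    simp only [mul_sub, sub_mul, mul_smul_comm, smul_mul_assoc, mul_one, one_mul]
    module
  rw [e, hx, hc, hab, one_smul, sub_sub_cancel_left, neg_add_cancel]

variable {f : End F V} {a b : F}

theorem range_sub_smul_le_eigenspace (h : (f - a • 1) * (f - b • 1) = 0) :
    (f - b • 1).range ≤ f.eigenspace a :=
  eigenspace_def (f := f) ▸ LinearMap.range_le_ker_iff.2 h

theorem eigenspace_le_range_sub_smul (hab : a ≠ b) : f.eigenspace a ≤ (f - b • 1).range := by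
  intro v hv
  refine ⟨(a - b)⁻¹ • v, ?_⟩
  rw [map_smul, inv_smul_eq_iff₀ (sub_ne_zero.2 hab), sub_smul]
  exact congrArg (· - b • v) (mem_eigenspace_iff.1 hv)

theorem eq_or_eq_of_hasEigenvalue (h : (f - a • 1) * (f - b • 1) = 0) {μ : F}
    (hμ : f.HasEigenvalue μ) : μ = a ∨ μ = b := by
  obtain ⟨v, hv⟩ := hμ.exists_hasEigenvector
  have hsub (s : F) : (f - s • 1) v = (μ - s) • v :=
    (congrArg (· - s • v) hv.apply_eq_smul).trans (sub_smul μ s v).symm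
  have h0 := LinearMap.congr_fun h v
  rw [mul_apply, hsub, map_smul, hsub, smul_smul] at h0
  exact (mul_eq_zero.1 ((smul_eq_zero.1 h0).resolve_right hv.2)).symm.imp sub_eq_zero.1
    sub_eq_zero.1

theorem isCompl_eigenspace (h : (f - a • 1) * (f - b • 1) = 0) (hab : a ≠ b) :
    IsCompl (f.eigenspace a) (f.eigenspace b) := by
  refine ⟨f.eigenspaces_iSupIndep.pairwiseDisjoint hab, codisjoint_iff_le_sup.2 fun v _ => ?_⟩
  have hcomm : (f - b • 1) * (f - a • 1) = 0 := by
    rw [← h]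
    simp only [mul_sub, sub_mul, mul_smul_comm, smul_mul_assoc, mul_one, one_mul]
    module
  have hv : v = (a - b)⁻¹ • (f - b • 1) v - (a - b)⁻¹ • (f - a • 1) v := by
    have e : (f - b • 1) v - (f - a • 1) v = (a - b) • v := by
      simp only [LinearMap.sub_apply, LinearMap.smul_apply, one_apply]
      module
    rw [← smul_sub, e, inv_smul_smul₀ (sub_ne_zero.2 hab)]
  rw [hv]
  exact Submodule.sub_mem_sup (Submodule.smul_mem _ _ (range_sub_smul_le_eigenspace h ⟨v, rfl⟩))
    (Submodule.smul_mem _ _ (range_sub_smul_le_eigenspace hcomm ⟨v, rfl⟩))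

theorem finrank_range_sub_smul_add_finrank_eigenspace [FiniteDimensional F V] (f : End F V)
    (a : F) : finrank F (f - a • 1).range + finrank F (f.eigenspace a) = finrank F V :=
  eigenspace_def (f := f) ▸ LinearMap.finrank_range_add_finrank_ker _

theorem finrank_le_finrank_eigenspace_add [FiniteDimensional F V]
    (h : (f - a • 1) * (f - b • 1) = 0) :
    finrank F V ≤ finrank F (f.eigenspace a) + finrank F (f.eigenspace b) :=
  finrank_range_sub_smul_add_finrank_eigenspace f b ▸
    Nat.add_le_add_right (Submodule.finrank_mono (range_sub_smul_le_eigenspace h)) _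

theorem det_eq_pow_mul_pow [FiniteDimensional F V] (h : (f - a • 1) * (f - b • 1) = 0) :
    LinearMap.det f = a ^ finrank F (f.eigenspace a) *
      b ^ (finrank F V - finrank F (f.eigenspace a)) := by
  set W := f.eigenspace a
  have hW (w) (hw : w ∈ W) : f w ∈ W := mem_eigenspace_iff.1 hw ▸ W.smul_mem a hw
  have hrestrict : f.restrict hW = a • 1 := by
    ext w
    exact mem_eigenspace_iff.1 w.2
  have hquot : W.mapQ W f hW = b • 1 := by
    ext v
    exact (Submodule.Quotient.eq W).2 (range_sub_smul_le_eigenspace h ⟨v, rfl⟩)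
  rw [LinearMap.det_eq_det_mul_det W f hW, hrestrict, hquot, LinearMap.det_smul,
    LinearMap.det_smul, map_one, map_one, mul_one, mul_one, Submodule.finrank_quotient]

theorem exists_hasEigenvector_of_finrank_lt [FiniteDimensional F V] {g : End F V}
    (h : finrank F V < finrank F (f.eigenspace a) + finrank F (g.eigenspace b)) :
    ∃ v, f.HasEigenvector a v ∧ g.HasEigenvector b v := by
  have hne : f.eigenspace a ⊓ g.eigenspace b ≠ ⊥ := fun h0 => h.not_ge <| by
    rw [← Submodule.finrank_sup_add_finrank_inf_eq, h0, finrank_bot, add_zero]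
    exact Submodule.finrank_le _
  obtain ⟨v, hv, hv0⟩ := Submodule.exists_mem_ne_zero_of_ne_bot hne
  exact ⟨v, ⟨hv.1, hv0⟩, hv.2, hv0⟩

end Quadratic

section Triangular

open Module Submodule

variable {F V : Type*} [Field F] [AddCommGroup V] [Module F V]

theorem det_eq_prod_of_sub_smul_mem_flag {n : ℕ} (b : Basis (Fin n) F V) {f : End F V}
    {e : Fin n → F} (h : ∀ i, f (b i) - e i • b i ∈ b.flag i.castSucc) :
    LinearMap.det f = ∏ i, e i := by
  have hentry {i j : Fin n} (hji : j ≤ i) :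
      LinearMap.toMatrix b b f i j = e j * if j = i then 1 else 0 := by
    have h0 : b.coord i (f (b j) - e j • b j) = 0 :=
      b.flag_le_ker_coord (Fin.castSucc_le_castSucc_iff.2 hji) (h j)
    rw [map_sub, map_smul, sub_eq_zero, b.coord_apply, b.coord_apply, b.repr_self,
      Finsupp.single_apply, smul_eq_mul] at h0
    rw [LinearMap.toMatrix_apply, h0]
  rw [← LinearMap.det_toMatrix b, Matrix.det_of_isUpperTriangular]
  · exact Finset.prod_congr rfl fun i _ => by rw [hentry le_rfl, if_pos rfl, mul_one]
  · intro i j hji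
    have hji' : j < i := hji
    rw [hentry hji'.le, if_neg hji'.ne, mul_zero]

theorem exists_basis_of_notMem_span [FiniteDimensional F V] {v : ℕ → V}
    (hv : ∀ n < finrank F V, v n ∉ span F (v '' Set.Iio n)) :
    ∃ b : Basis (Fin (finrank F V)) F V, ∀ i, b i = v i := by
  have hli (n : ℕ) (hn : n ≤ finrank F V) : LinearIndependent F fun i : Fin n => v i := by
    induction n with
    | zero => exact linearIndependent_empty_type
    | succ n ih =>
      have hrange : Set.range (fun i : Fin n => v i) = v '' Set.Iio n := by
        rw [← Fin.range_val, ← Set.range_comp]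
        rfl
      exact linearIndependent_finSucc'.2 ⟨ih (by lia), hrange ▸ hv n hn⟩
  exact ⟨basisOfLinearIndependentOfCardEqFinrank' _ (hli _ le_rfl) (Fintype.card_fin _),
    fun i => by rw [coe_basisOfLinearIndependentOfCardEqFinrank']⟩

theorem det_eq_prod_of_sub_smul_mem_span [FiniteDimensional F V] {v : ℕ → V}
    (hv : ∀ n < finrank F V, v n ∉ span F (v '' Set.Iio n)) {f : End F V} {e : ℕ → F}
    (hf : ∀ n, f (v n) - e n • v n ∈ span F (v '' Set.Iio n)) :
    LinearMap.det f = ∏ n ∈ Finset.range (finrank F V), e n := by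
  obtain ⟨b, hb⟩ := exists_basis_of_notMem_span hv
  rw [← Fin.prod_univ_eq_prod_range]
  refine det_eq_prod_of_sub_smul_mem_flag b fun i => ?_
  have hspan : span F (v '' Set.Iio i) ≤ b.flag i.castSucc := by
    refine span_le.2 (Set.forall_mem_image.2 fun j hj => ?_)
    exact hb ⟨j, hj.trans i.2⟩ ▸ b.self_mem_flag hj
  exact hb i ▸ hspan (hf i)

end Triangular

section Chain

open Module Module.End

variable {F V : Type*} [Field F] [AddCommGroup V] [Module F V]

theorem sup_span_singleton_mem_invtSubmodule {W : Submodule F V} {f : End F V} {v : V}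
    (hW : W ∈ f.invtSubmodule) (hv : f v ∈ W ⊔ Submodule.span F {v}) :
    W ⊔ Submodule.span F {v} ∈ f.invtSubmodule := by
  rw [mem_invtSubmodule, sup_le_iff, Submodule.span_singleton_le_iff_mem]
  exact ⟨fun _ hw => Submodule.mem_sup_left (hW hw), hv⟩

theorem mem_sup_span_singleton_of_sub_smul_mem {W : Submodule F V} {v w : V} {e : F}
    (h : w - e • v ∈ W) : w ∈ W ⊔ Submodule.span F {v} :=
  sub_add_cancel w (e • v) ▸ Submodule.add_mem_sup h (Submodule.mem_span_singleton.2 ⟨e, rfl⟩)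

theorem inverse_sub_smul_mem {W : Submodule F V} {f g : End F V} (hgf : g * f = 1)
    (hW : W ∈ g.invtSubmodule) {v : V} {e : F} (he : e ≠ 0) (h : f v - e • v ∈ W) :
    g v - e⁻¹ • v ∈ W := by
  have hv : g (f v) = v := LinearMap.congr_fun hgf v
  have h' : g (f v - e • v) ∈ W := hW h
  rw [map_sub, map_smul, hv, ← neg_mem_iff, neg_sub] at h'
  have e' : e⁻¹ • (e • g v - v) = g v - e⁻¹ • v := by rw [smul_sub, inv_smul_smul₀ he]
  exact e' ▸ W.smul_mem e⁻¹ h'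

/-- The operator that extends the chain of vectors at its `n`-th place. -/
def chainStep (t : Fin 4 → End F V) (n : ℕ) : End F V := if Even n then t 2 else t 0

/-- The chain `v, t₂v, t₀t₂v, t₂t₀t₂v, …`, along which `t₀t₁` is triangular when `v` is a common
eigenvector of `t₀` and `t₁`. -/
def chain (t : Fin 4 → End F V) (v : V) : ℕ → V
  | 0 => v
  | n + 1 => chainStep t n (chain t v n)

/-- The span of the first `n` vectors of the chain. -/
def chainSpan (t : Fin 4 → End F V) (v : V) (n : ℕ) : Submodule F V :=
  Submodule.span F (chain t v '' Set.Iio n)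

/-- The ratio between the eigenvalue of `t₀t₁` at place `n + 1` of the chain and that of
`(t₀t₁)⁻¹` at place `n`. -/
def chainRatio (q : F) (n : ℕ) : F := if Even n then q⁻¹ ^ 2 else 1

/-- The diagonal entries of `t₀t₁` along the chain. -/
def chainEigenvalue (q x : F) : ℕ → F
  | 0 => x
  | n + 1 => chainRatio q n * (chainEigenvalue q x n)⁻¹

theorem chainEigenvalue_ne_zero {q x : F} (hq : q ≠ 0) (hx : x ≠ 0) (n : ℕ) :
    chainEigenvalue q x n ≠ 0 := by
  induction n with
  | zero => exact hx
  | succ n ih =>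
    refine mul_ne_zero ?_ (inv_ne_zero ih)
    rw [chainRatio]
    split_ifs
    exacts [pow_ne_zero _ (inv_ne_zero hq), one_ne_zero]

theorem chainEigenvalue_mul_succ {q x : F} (hq : q ≠ 0) (hx : x ≠ 0) (n : ℕ) :
    chainEigenvalue q x n * chainEigenvalue q x (n + 1) = chainRatio q n := by
  rw [chainEigenvalue, mul_left_comm, mul_inv_cancel₀ (chainEigenvalue_ne_zero hq hx n), mul_one]

theorem prod_chainEigenvalue {q x : F} (hq : q ≠ 0) (hx : x ≠ 0) (n : ℕ) :
    ∏ k ∈ Finset.range n, chainEigenvalue q x k = if Even n then q⁻¹ ^ n else x := by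
  induction n using Nat.twoStepInduction with
  | zero => simp
  | one => simp [chainEigenvalue]
  | more n ih _ =>
    rw [Finset.prod_range_succ, Finset.prod_range_succ, mul_assoc,
      chainEigenvalue_mul_succ hq hx, ih, chainRatio]
    by_cases hn : Even n
    · rw [if_pos hn, if_pos hn, if_pos (hn.add even_two), pow_add]
    · rw [if_neg hn, if_neg hn, if_neg (by simpa [Nat.even_add] using hn), mul_one]

theorem chainSpan_succ (t : Fin 4 → End F V) (v : V) (n : ℕ) :
    chainSpan t v (n + 1) = chainSpan t v n ⊔ Submodule.span F {chain t v n} := by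
  rw [chainSpan, ← Order.succ_eq_add_one, Order.Iio_succ_eq_insert, Set.image_insert_eq,
    Submodule.span_insert, sup_comm, chainSpan]

theorem finrank_chainSpan_le (t : Fin 4 → End F V) (v : V) (n : ℕ) :
    finrank F (chainSpan t v n) ≤ n := by
  classical
  have h := finrank_span_finset_le_card (R := F) ((Finset.range n).image (chain t v))
  rw [Finset.coe_image, Finset.coe_range] at h
  exact h.trans (Finset.card_image_le.trans (Finset.card_range n).le)

namespace IsDAHATuple

variable {q : F} {t : Fin 4 → End F V} {c : Fin 4 → F} (H : IsDAHATuple q t c)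
include H

theorem exists_chainStep_mul_self (n : ℕ) :
    ∃ r : F, chainStep t n * chainStep t n = r • chainStep t n - 1 := by
  rw [chainStep]
  split_ifs
  exacts [⟨c 2, H.mul_self 2⟩, ⟨c 0, H.mul_self 0⟩]

theorem exists_mul_chainStep (hq : q ≠ 0) (n : ℕ) :
    ∃ r₁ r₂ r₃ : F, t 0 * t 1 * chainStep t n =
      chainRatio q n • (chainStep t n * (tInv t c 1 * tInv t c 0)) +
        (r₁ • 1 + r₂ • (t 0 * t 1) + r₃ • (tInv t c 1 * tInv t c 0)) := by
  rw [chainStep, chainRatio]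
  split_ifs
  · have hY : tInv t c 1 * tInv t c 0 = q • (t 2 * t 3) := H.tInv_mul_tInv_eq hq 2
    have h012 : t 0 * t 1 * t 2 = q⁻¹ • tInv t c 3 := H.mul_mul_eq 0
    have hq2 : q⁻¹ ^ 2 * q = q⁻¹ := by rw [pow_two, inv_mul_cancel_right₀ hq]
    refine ⟨q⁻¹ * c 3, 0, -(q⁻¹ ^ 2 * c 2), ?_⟩
    rw [hY, h012, mul_smul_comm, ← mul_assoc, H.mul_self, tInv, sub_mul, smul_mul_assoc, one_mul,
      smul_smul, smul_smul, neg_mul, mul_right_comm, hq2]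
    module
  · refine ⟨-c 1, c 0, 0, ?_⟩
    have e : t 0 * (t 1 * t 0) = t 0 * t 1 * t 0 := (mul_assoc _ _ _).symm
    simp only [tInv, mul_sub, sub_mul, smul_mul_assoc, mul_smul_comm, mul_one, one_mul,
      H.mul_self, e]
    module

theorem tInv_mul_tInv_mul_mul_eq_one : tInv t c 1 * tInv t c 0 * (t 0 * t 1) = 1 := by
  rw [mul_assoc, H.tInv_mul_cancel_left, H.tInv_mul]

theorem mul_apply_chainStep_sub_smul_mem (hq : q ≠ 0) {n : ℕ} {W : Submodule F V} {x : V} {e : F}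
    (he : e ≠ 0) (hs : W ∈ (chainStep t n).invtSubmodule)
    (hY : W ∈ (tInv t c 1 * tInv t c 0).invtSubmodule) (hx : (t 0 * t 1) x - e • x ∈ W) :
    (t 0 * t 1) (chainStep t n x) - (chainRatio q n * e⁻¹) • chainStep t n x ∈
      W ⊔ Submodule.span F {x} := by
  set M := W ⊔ Submodule.span F {x}
  have hYx := inverse_sub_smul_mem H.tInv_mul_tInv_mul_mul_eq_one hY he hx
  have hxM : x ∈ M := Submodule.mem_sup_right (Submodule.mem_span_singleton_self x)
  obtain ⟨r₁, r₂, r₃, hr⟩ := H.exists_mul_chainStep hq n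
  have hsplit : (t 0 * t 1) (chainStep t n x) - (chainRatio q n * e⁻¹) • chainStep t n x =
      chainRatio q n • chainStep t n ((tInv t c 1 * tInv t c 0) x - e⁻¹ • x) +
        (r₁ • x + r₂ • (t 0 * t 1) x + r₃ • (tInv t c 1 * tInv t c 0) x) := by
    rw [← mul_apply, hr, map_sub, map_smul]
    simp only [LinearMap.add_apply, LinearMap.smul_apply, mul_apply, one_apply]
    module
  rw [hsplit]
  exact M.add_mem (M.smul_mem _ (Submodule.mem_sup_left (hs hYx)))
    (M.add_mem (M.add_mem (M.smul_mem _ hxM)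
      (M.smul_mem _ (mem_sup_span_singleton_of_sub_smul_mem hx)))
      (M.smul_mem _ (mem_sup_span_singleton_of_sub_smul_mem hYx)))

section Eigenvector

variable {θ a : F} {v : V} (h0 : (t 0).HasEigenvector θ v)
include h0

theorem chainSpan_mem_invtSubmodule_chainStep (n : ℕ) :
    chainSpan t v n ∈ (chainStep t n).invtSubmodule := by
  induction n using Nat.twoStepInduction with
  | zero => simp [chainSpan]
  | one =>
    have h : chainStep t 1 v = θ • v := h0.apply_eq_smul
    have hbot : chainSpan t v 0 = ⊥ := by simp [chainSpan]
    rw [chainSpan_succ, hbot]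
    refine sup_span_singleton_mem_invtSubmodule (invtSubmodule.bot_mem _) ?_
    exact Submodule.mem_sup_right (Submodule.mem_span_singleton.2 ⟨θ, h.symm⟩)
  | more n ih _ =>
    have hstep : chainStep t (n + 2) = chainStep t n := by simp [chainStep, Nat.even_add]
    obtain ⟨r, hr⟩ := H.exists_chainStep_mul_self n
    set x := chain t v n
    have hss : chainStep t n (chainStep t n x) = r • chainStep t n x - x :=
      LinearMap.congr_fun hr x
    rw [chainSpan_succ, chainSpan_succ, hstep, sup_assoc, ← Submodule.span_union,
      Set.union_singleton, chain]
    set M := chainSpan t v n ⊔ Submodule.span F {chainStep t n x, x}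
    have hspan {y : V} (hy : y ∈ ({chainStep t n x, x} : Set V)) : y ∈ M :=
      Submodule.mem_sup_right (Submodule.subset_span hy)
    rw [mem_invtSubmodule, sup_le_iff, Submodule.span_le, Set.pair_subset_iff]
    refine ⟨fun w hw => Submodule.mem_sup_left (ih hw), ?_, hspan (.inl rfl)⟩
    have hM : r • chainStep t n x - x ∈ M :=
      M.sub_mem (M.smul_mem r (hspan (.inl rfl))) (hspan (.inr rfl))
    rwa [← hss] at hM

theorem chainSpan_mem_invtSubmodule_mul (hq : q ≠ 0) (h1 : (t 1).HasEigenvector a v)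
    (hx : θ * a ≠ 0) (n : ℕ) :
    chainSpan t v n ∈ (t 0 * t 1).invtSubmodule ∧
    chainSpan t v n ∈ (tInv t c 1 * tInv t c 0).invtSubmodule ∧
    (t 0 * t 1) (chain t v n) - chainEigenvalue q (θ * a) n • chain t v n ∈ chainSpan t v n := by
  induction n with
  | zero =>
    have h : (t 0 * t 1) v = (θ * a) • v := by
      rw [mul_apply, h1.apply_eq_smul, map_smul, h0.apply_eq_smul, smul_smul, mul_comm]
    simp [chainSpan, chain, chainEigenvalue, h]
  | succ n ih =>
    obtain ⟨hX, hY, hn⟩ := ih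
    have he := chainEigenvalue_ne_zero hq hx n
    rw [chainSpan_succ]
    exact ⟨sup_span_singleton_mem_invtSubmodule hX (mem_sup_span_singleton_of_sub_smul_mem hn),
      sup_span_singleton_mem_invtSubmodule hY (mem_sup_span_singleton_of_sub_smul_mem
        (inverse_sub_smul_mem H.tInv_mul_tInv_mul_mul_eq_one hY he hn)),
      H.mul_apply_chainStep_sub_smul_mem hq he
        (H.chainSpan_mem_invtSubmodule_chainStep h0 n) hY hn⟩

end Eigenvector

end IsDAHATuple

end Chain

section Determinants

open Module Module.End

variable {F V : Type*} [Field F] [AddCommGroup V] [Module F V]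

theorem isOfFinOrder_of_mul_eq_one_of_eq_pow_mul_pow {a b : F} (hab : a * b = 1) {p m : ℕ}
    (hmp : m + 1 < p) (h : a = a ^ p * b ^ m) : IsOfFinOrder a := by
  have ha : a ≠ 0 := left_ne_zero_of_mul_eq_one hab
  have h' : a ^ (m + 1) = a ^ p := by
    nth_rewrite 1 [pow_succ', h]
    rw [mul_assoc, ← mul_pow, mul_comm b, hab, one_pow, mul_one]
  refine isOfFinOrder_iff_pow_eq_one.2 ⟨p - (m + 1), Nat.sub_pos_of_lt hmp, ?_⟩
  rw [pow_sub₀ _ ha hmp.le, h', mul_inv_cancel₀ (pow_ne_zero _ ha)]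

theorem IsGeneric.not_isOfFinOrder_inv_pow {q : F} (hq : IsGeneric q) {n : ℕ} (hn : 0 < n) :
    ¬ IsOfFinOrder (q⁻¹ ^ n) := by
  rw [isOfFinOrder_iff_pow_eq_one]
  rintro ⟨m, hm, h⟩
  rw [← pow_mul, inv_pow, inv_eq_one] at h
  exact hq.pow_ne_one _ (Nat.mul_pos hn hm) h

theorem exists_finrank_le_two_mul_finrank_eigenspace [IsAlgClosed F] [FiniteDimensional F V]
    {f : End F V} {c : F} (hf : f * f = c • f - 1) :
    ∃ a b : F, a * b = 1 ∧ a + b = c ∧ finrank F V ≤ 2 * finrank F (f.eigenspace a) := by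
  obtain ⟨a, b, hab, hc⟩ := exists_mul_eq_one_add_eq c
  have hquad : (f - a • 1) * (f - b • 1) = 0 := sub_smul_mul_sub_smul_eq_zero hf hab hc
  have h := finrank_le_finrank_eigenspace_add hquad
  obtain h' | h' := le_total (finrank F (f.eigenspace b)) (finrank F (f.eigenspace a))
  · exact ⟨a, b, hab, hc, by lia⟩
  · exact ⟨b, a, mul_comm a b ▸ hab, add_comm a b ▸ hc, by lia⟩

namespace IsDAHATuple

variable {q : F} {t : Fin 4 → End F V} {c : Fin 4 → F} (H : IsDAHATuple q t c)
include H

theorem eigenvalue_mul_sub_eq_one {i : Fin 4} {a : F} {v : V} (hv : (t i).HasEigenvector a v) :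
    a * (c i - a) = 1 := by
  refine smul_left_injective F hv.2 ?_
  have h := LinearMap.congr_fun (H.mul_tInv i) v
  simpa only [mul_apply, tInv, LinearMap.sub_apply, LinearMap.smul_apply, one_apply,
    hv.apply_eq_smul, ← sub_smul, map_smul, smul_smul, mul_comm a, one_smul] using h

theorem eigenvalue_ne_zero {i : Fin 4} {a : F} {v : V} (hv : (t i).HasEigenvector a v) : a ≠ 0 :=
  left_ne_zero_of_mul_eq_one (H.eigenvalue_mul_sub_eq_one hv)

theorem mem_invtSubmodule_of_mul_mem {W : Submodule F V} {i : Fin 4} {f : End F V}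
    (hi : W ∈ (t i).invtSubmodule) (hf : W ∈ (t i * f).invtSubmodule) : W ∈ f.invtSubmodule := by
  intro w hw
  have h : tInv t c i ((t i * f) w) ∈ W := W.sub_mem (W.smul_mem _ (hf hw)) (hi (hf hw))
  have e : tInv t c i ((t i * f) w) = f w :=
    LinearMap.congr_fun (H.tInv_mul_cancel_left i f) w
  rwa [e] at h

theorem mem_adjoin_braid (i : Fin 4) : t i ∈
    Algebra.adjoin F (Set.range ![t 0, t 2, tInv t c 2 * t 1 * t 2, t 3]) := by
  set A := Algebra.adjoin F (Set.range ![t 0, t 2, tInv t c 2 * t 1 * t 2, t 3])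
  have hmem (j : Fin 4) : ![t 0, t 2, tInv t c 2 * t 1 * t 2, t 3] j ∈ A :=
    Algebra.subset_adjoin ⟨j, rfl⟩
  fin_cases i
  · exact hmem 0
  · have e : t 2 * (tInv t c 2 * t 1 * t 2) * tInv t c 2 = t 1 := by
      rw [← mul_assoc, H.mul_tInv_cancel_right, H.mul_tInv_cancel_left]
    exact e ▸ A.mul_mem (A.mul_mem (hmem 1) (hmem 2))
      (A.sub_mem (A.smul_mem A.one_mem _) (hmem 1))
  · exact hmem 1
  · exact hmem 3

section CommonEigenvector

variable {θ a : F} {v : V}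

theorem mem_invtSubmodule_of_mul {W : Submodule F V} (h0 : W ∈ (t 0).invtSubmodule)
    (h2 : W ∈ (t 2).invtSubmodule) (h01 : W ∈ (t 0 * t 1).invtSubmodule)
    (h10 : W ∈ (tInv t c 1 * tInv t c 0).invtSubmodule) (i : Fin 4) :
    W ∈ (t i).invtSubmodule := by
  fin_cases i
  · exact h0
  · exact H.mem_invtSubmodule_of_mul_mem h0 h01
  · exact h2
  · refine H.mem_invtSubmodule_of_mul_mem h2 fun w hw => ?_
    exact (H.mul_eq 2).symm ▸ W.smul_mem q⁻¹ (h10 hw)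

theorem chain_notMem_chainSpan [FiniteDimensional F V] (hirr : ActsIrreducibly t) (hq : q ≠ 0)
    (h0 : (t 0).HasEigenvector θ v) (h1 : (t 1).HasEigenvector a v) {n : ℕ}
    (hn : n < finrank F V) : chain t v n ∉ chainSpan t v n := by
  intro hmem
  have hx : θ * a ≠ 0 := mul_ne_zero (H.eigenvalue_ne_zero h0) (H.eigenvalue_ne_zero h1)
  have hn0 : n ≠ 0 := by
    rintro rfl
    exact h0.2 (by simpa [chainSpan, chain] using hmem)
  obtain ⟨h01, h10, -⟩ := H.chainSpan_mem_invtSubmodule_mul h0 hq h1 hx n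
  have hstep := H.chainSpan_mem_invtSubmodule_chainStep h0 n
  have hstep' := H.chainSpan_mem_invtSubmodule_chainStep h0 (n + 1)
  rw [chainSpan_succ, sup_eq_left.2 ((Submodule.span_singleton_le_iff_mem _ _).2 hmem)] at hstep'
  have h02 : chainSpan t v n ∈ (t 0).invtSubmodule ∧ chainSpan t v n ∈ (t 2).invtSubmodule := by
    simp only [chainStep, Nat.even_add_one] at hstep hstep'
    split_ifs at hstep hstep' with hpar
    exacts [⟨hstep', hstep⟩, ⟨hstep, hstep'⟩]
  have hv : v ∈ chainSpan t v n := Submodule.subset_span ⟨0, Nat.pos_of_ne_zero hn0, rfl⟩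
  obtain h | h := hirr _ (H.mem_invtSubmodule_of_mul h02.1 h02.2 h01 h10)
  · exact h0.2 (by simpa [h] using hv)
  · exact hn.not_ge (finrank_top F V ▸ h ▸ finrank_chainSpan_le t v n)

variable [FiniteDimensional F V]

theorem det_mul_det_one (hirr : ActsIrreducibly t) (hq : q ≠ 0) (h0 : (t 0).HasEigenvector θ v)
    (h1 : (t 1).HasEigenvector a v) :
    LinearMap.det (t 0) * LinearMap.det (t 1) =
      if Even (finrank F V) then q⁻¹ ^ finrank F V else θ * a := by
  have hx : θ * a ≠ 0 := mul_ne_zero (H.eigenvalue_ne_zero h0) (H.eigenvalue_ne_zero h1)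
  rw [← map_mul, ← prod_chainEigenvalue hq hx]
  exact det_eq_prod_of_sub_smul_mem_span (fun n => H.chain_notMem_chainSpan hirr hq h0 h1)
    fun n => (H.chainSpan_mem_invtSubmodule_mul h0 hq h1 hx n).2.2

theorem det_mul_det (hirr : ActsIrreducibly t) (hq : q ≠ 0) {i : Fin 4} (hi : i ≠ 0)
    (h0 : (t 0).HasEigenvector θ v) (h1 : (t i).HasEigenvector a v) :
    LinearMap.det (t 0) * LinearMap.det (t i) =
      if Even (finrank F V) then q⁻¹ ^ finrank F V else θ * a := by
  fin_cases i
  · exact absurd rfl hi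
  · exact H.det_mul_det_one hirr hq h0 h1
  · exact H.braid.det_mul_det_one (hirr.of_mem_adjoin H.mem_adjoin_braid) hq h0 h1
  · rw [mul_comm, mul_comm θ]
    refine H.rotate.rotate.rotate.det_mul_det_one (hirr.of_mem_adjoin fun i => ?_) hq h1 h0
    exact Algebra.subset_adjoin ⟨i + 1, by fin_cases i <;> rfl⟩

theorem finrank_le_two_of_eq_smul_one [IsAlgClosed F] [Nontrivial V] (hirr : ActsIrreducibly t)
    (hq : q ≠ 0) (h0 : t 0 = θ • 1) : finrank F V ≤ 2 := by
  by_contra! hlt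
  obtain ⟨a, ha⟩ := Module.End.exists_eigenvalue (t 1)
  obtain ⟨v, hv⟩ := ha.exists_hasEigenvector
  have hv0 : (t 0).HasEigenvector θ v := ⟨mem_eigenspace_iff.2 (by simp [h0]), hv.2⟩
  refine H.chain_notMem_chainSpan hirr hq hv0 hv hlt ?_
  have h2 : chain t v 2 = θ • chain t v 1 := by simp [chain, chainStep, h0]
  rw [h2]
  exact Submodule.smul_mem _ _ (Submodule.subset_span ⟨1, by simp, rfl⟩)

end CommonEigenvector

variable [FiniteDimensional F V]

theorem det_prod : LinearMap.det (t 0) * LinearMap.det (t 1) * LinearMap.det (t 2) *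
    LinearMap.det (t 3) = q⁻¹ ^ finrank F V := by
  rw [← map_mul, ← map_mul, ← map_mul, H.prod, LinearMap.det_smul, map_one, mul_one]

theorem exists_ne_zero_of_isOfFinOrder_det [Nontrivial V] (hq : IsGeneric q)
    (h0 : IsOfFinOrder (LinearMap.det (t 0))) : ∃ i ≠ 0, c i ≠ 0 := by
  by_contra! hc
  have hfin (i) (hi : i ≠ 0) : IsOfFinOrder (LinearMap.det (t i)) := by
    have hsq : t i ^ 2 = -1 := by rw [pow_two, H.mul_self, hc i hi, zero_smul, zero_sub]
    refine LinearMap.det.isOfFinOrder (isOfFinOrder_iff_pow_eq_one.2 ⟨2 * 2, by norm_num, ?_⟩)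
    rw [pow_mul, hsq, neg_one_sq]
  refine hq.not_isOfFinOrder_inv_pow (finrank_pos (R := F) (M := V)) ?_
  rw [← H.det_prod]
  exact ((h0.mul (hfin 1 (by decide))).mul (hfin 2 (by decide))).mul (hfin 3 (by decide))

section SelfInverse

variable {θ : F} (hθ : θ * θ = 1) (hc : θ + θ = c 0)
include hθ hc

theorem det_zero_eq_pow : LinearMap.det (t 0) = θ ^ finrank F V := by
  have hquad : (t 0 - θ • 1) * (t 0 - θ • 1) = 0 :=
    sub_smul_mul_sub_smul_eq_zero (H.mul_self 0) hθ hc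
  rw [det_eq_pow_mul_pow hquad, ← pow_add,
    Nat.add_sub_cancel' (Submodule.finrank_le _)]

theorem det_zero_eq_one_of_even (heven : Even (finrank F V)) : LinearMap.det (t 0) = 1 := by
  obtain ⟨m, hm⟩ := heven
  rw [H.det_zero_eq_pow hθ hc, hm, pow_add, ← mul_pow, hθ, one_pow]

theorem isOfFinOrder_det_zero : IsOfFinOrder (LinearMap.det (t 0)) := by
  have h : IsOfFinOrder θ := isOfFinOrder_iff_pow_eq_one.2 ⟨2, two_pos, by rw [pow_two, hθ]⟩
  exact H.det_zero_eq_pow hθ hc ▸ h.pow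

variable (hirr : ActsIrreducibly t)
include hirr

theorem det_eq_inv_pow_of_even [IsAlgClosed F] (hq : q ≠ 0)
    (hlt : finrank F V + 1 < 2 * finrank F ((t 0).eigenspace θ)) (heven : Even (finrank F V))
    {i : Fin 4} (hi : i ≠ 0) : LinearMap.det (t i) = q⁻¹ ^ finrank F V := by
  obtain ⟨a, b, -, -, hle⟩ := exists_finrank_le_two_mul_finrank_eigenspace (H.mul_self i)
  obtain ⟨v, h0, h1⟩ := exists_hasEigenvector_of_finrank_lt (f := t 0) (g := t i)
    (a := θ) (b := a) (by lia)
  have h := H.det_mul_det hirr hq hi h0 h1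
  rwa [if_pos heven, H.det_zero_eq_one_of_even hθ hc heven, one_mul] at h

theorem det_eq_of_odd (hq : q ≠ 0) (hodd : Odd (finrank F V)) {i : Fin 4} (hi : i ≠ 0) {a : F}
    (hlt : finrank F V < finrank F ((t 0).eigenspace θ) + finrank F ((t i).eigenspace a)) :
    LinearMap.det (t i) = a := by
  obtain ⟨v, h0, h1⟩ := exists_hasEigenvector_of_finrank_lt hlt
  have h := H.det_mul_det hirr hq hi h0 h1
  obtain ⟨m, hm⟩ := hodd
  have hdet : LinearMap.det (t 0) = θ := by
    rw [H.det_zero_eq_pow hθ hc, hm, pow_succ, pow_mul, pow_two, hθ, one_pow, one_mul]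
  rw [if_neg (Nat.not_even_iff_odd.2 ⟨m, hm⟩), hdet] at h
  exact mul_left_cancel₀ (left_ne_zero_of_mul_eq_one hθ) h

variable [IsAlgClosed F]

theorem isOfFinOrder_det_of_odd (hq : q ≠ 0)
    (hlt : finrank F V + 1 < 2 * finrank F ((t 0).eigenspace θ)) (hodd : Odd (finrank F V))
    {i : Fin 4} (hi : i ≠ 0) : IsOfFinOrder (LinearMap.det (t i)) := by
  obtain ⟨a, b, hab, hac, hle⟩ := exists_finrank_le_two_mul_finrank_eigenspace (H.mul_self i)
  have hquad : (t i - a • 1) * (t i - b • 1) = 0 :=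
    sub_smul_mul_sub_smul_eq_zero (H.mul_self i) hab hac
  have hdim := finrank_le_finrank_eigenspace_add hquad
  have ha : LinearMap.det (t i) = a := H.det_eq_of_odd hθ hc hirr hq hodd hi (by lia)
  by_cases hb : finrank F V < finrank F ((t 0).eigenspace θ) + finrank F ((t i).eigenspace b)
  · have hba : a = b := ha.symm.trans (H.det_eq_of_odd hθ hc hirr hq hodd hi hb)
    rw [ha]
    exact isOfFinOrder_iff_pow_eq_one.2 ⟨2, two_pos, by rw [pow_two, ← hab, ← hba]⟩
  · have hdet := det_eq_pow_mul_pow hquad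
    rw [ha] at hdet ⊢
    exact isOfFinOrder_of_mul_eq_one_of_eq_pow_mul_pow hab (by lia) hdet

theorem two_mul_finrank_eigenspace_le [Nontrivial V] (hq : IsGeneric q) :
    2 * finrank F ((t 0).eigenspace θ) ≤ finrank F V + 1 := by
  by_contra! hlt
  have hq0 := hq.ne_zero
  refine hq.not_isOfFinOrder_inv_pow (finrank_pos (R := F) (M := V)) ?_
  obtain heven | hodd := Nat.even_or_odd (finrank F V)
  · have hdet (i) (hi : i ≠ 0) := H.det_eq_inv_pow_of_even hθ hc hirr hq0 hlt heven hi
    have hprod := H.det_prod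
    rw [H.det_zero_eq_one_of_even hθ hc heven, hdet 1 (by decide), hdet 2 (by decide),
      hdet 3 (by decide), one_mul] at hprod
    refine isOfFinOrder_iff_pow_eq_one.2 ⟨2, two_pos, ?_⟩
    rw [pow_two]
    exact mul_right_cancel₀ (pow_ne_zero _ (inv_ne_zero hq0)) (hprod.trans (one_mul _).symm)
  · have hdet (i) (hi : i ≠ 0) := H.isOfFinOrder_det_of_odd hθ hc hirr hq0 hlt hodd hi
    rw [← H.det_prod]
    exact (((H.isOfFinOrder_det_zero hθ hc).mul (hdet 1 (by decide))).mul (hdet 2 (by decide))).mul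
      (hdet 3 (by decide))

end SelfInverse

end IsDAHATuple

end Determinants

section Classification

open Module Module.End

variable {F V : Type*} [Field F] [AddCommGroup V] [Module F V]

theorem inf_eigenspace_ne_bot {f : End F V} {a b : F} (h : (f - a • 1) * (f - b • 1) = 0)
    {W : Submodule F V} (hW : W ∈ f.invtSubmodule) (hle : ¬ W ≤ f.eigenspace b) :
    W ⊓ f.eigenspace a ≠ ⊥ := by
  obtain ⟨w, hw, hwb⟩ := SetLike.not_le_iff_exists.1 hle
  rw [eigenspace_def, LinearMap.mem_ker] at hwb
  exact (Submodule.ne_bot_iff _).2 ⟨(f - b • 1) w,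
    ⟨W.sub_mem (hW hw) (W.smul_mem b hw), range_sub_smul_le_eigenspace h ⟨w, rfl⟩⟩, hwb⟩

variable {q : F} {t : Fin 4 → End F V} {c : Fin 4 → F} {W : Submodule F V} {θ θ' : F}

namespace IsDAHATuple

variable (H : IsDAHATuple q t c) (hirr : ActsIrreducibly t)
include H

theorem invtSubmodule_t_zero_of_isOfFinOrder_det [FiniteDimensional F V] [Nontrivial V]
    (hq : IsGeneric q) (h0 : IsOfFinOrder (LinearMap.det (t 0))) (hW : IsSymInvariant t c W) :
    W ∈ (t 0).invtSubmodule :=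
  have ⟨_, hi, hci⟩ := H.exists_ne_zero_of_isOfFinOrder_det hq h0
  H.invtSubmodule_t_zero hq hi hci hW

include hirr

theorem le_eigenspace_or_eq_top [FiniteDimensional F V] [Nontrivial V] (hq : IsGeneric q)
    (hθ : θ * θ = 1) (hc : θ + θ = c 0) (hW : IsSymInvariant t c W) :
    W ≤ (t 0).eigenspace θ ∨ W = ⊤ := by
  by_contra! ⟨hle, htop⟩
  have hquad : (t 0 - θ • 1) * (t 0 - θ • 1) = 0 :=
    sub_smul_mul_sub_smul_eq_zero (H.mul_self 0) hθ hc
  have h0 := H.invtSubmodule_t_zero_of_isOfFinOrder_det hq (H.isOfFinOrder_det_zero hθ hc) hW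
  have hrange : (t 0 - θ • 1).range ≤ W :=
    (H.range_le_of_le_eigenspace hirr hq.ne_zero hc (hW.inf (H.isSymInvariant_eigenspace θ))
      (inf_eigenspace_ne_bot hquad h0 hle) inf_le_right).trans inf_le_left
  exact hle (H.le_eigenspace_of_range_le hirr hq.ne_zero hc hW htop hrange)

section Distinct

variable (hc : θ + θ' = c 0) (hne : θ ≠ θ')
include hc hne

theorem eigenspace_le_of_inf_ne_bot (hq : q ≠ 0) (hW : IsSymInvariant t c W)
    (h : W ⊓ (t 0).eigenspace θ ≠ ⊥) : (t 0).eigenspace θ ≤ W :=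
  (eigenspace_le_range_sub_smul hne).trans <|
    (H.range_le_of_le_eigenspace hirr hq hc (hW.inf (H.isSymInvariant_eigenspace θ)) h
      inf_le_right).trans inf_le_left

variable (hθ : θ * θ' = 1)
include hθ

theorem eq_eigenspace_or_eq_top (hq : q ≠ 0) (hW : IsSymInvariant t c W)
    (hle : (t 0).eigenspace θ ≤ W) : W = (t 0).eigenspace θ ∨ W = ⊤ := by
  have hquad : (t 0 - θ • 1) * (t 0 - θ' • 1) = 0 :=
    sub_smul_mul_sub_smul_eq_zero (H.mul_self 0) hθ hc
  have hcompl := isCompl_eigenspace hquad hne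
  by_cases h : W ⊓ (t 0).eigenspace θ' = ⊥
  · refine Or.inl (eq_of_le_of_inf_le_of_sup_le hle (h.trans_le bot_le) ?_).symm
    rw [hcompl.sup_eq_top]
    exact le_top
  · have hle' := H.eigenspace_le_of_inf_ne_bot hirr ((add_comm _ _).trans hc) hne.symm hq hW h
    exact Or.inr (top_le_iff.1 (hcompl.sup_eq_top ▸ sup_le hle hle'))

theorem isCompl_eigenspace_of_inf_eq_bot (hq : q ≠ 0) (hW : IsSymInvariant t c W) (hbot : W ≠ ⊥)
    (h : W ⊓ (t 0).eigenspace θ = ⊥) : IsCompl W ((t 0).eigenspace θ) := by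
  refine ⟨disjoint_iff.2 h, codisjoint_iff.2 ?_⟩
  refine (H.eq_eigenspace_or_eq_top hirr hc hne hθ hq (hW.sup (H.isSymInvariant_eigenspace θ))
    le_sup_right).resolve_left fun hsup => hbot ?_
  rwa [inf_eq_left.2 (sup_eq_right.1 hsup)] at h

theorem inf_eigenspace_ne_bot_or [FiniteDimensional F V] [Nontrivial V] (hq : IsGeneric q)
    (hW : IsSymInvariant t c W) (hbot : W ≠ ⊥) :
    W ⊓ (t 0).eigenspace θ ≠ ⊥ ∨ W ⊓ (t 0).eigenspace θ' ≠ ⊥ := by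
  by_contra! ⟨h, h'⟩
  have hquad : (t 0 - θ • 1) * (t 0 - θ' • 1) = 0 :=
    sub_smul_mul_sub_smul_eq_zero (H.mul_self 0) hθ hc
  have hcompl := H.isCompl_eigenspace_of_inf_eq_bot hirr hc hne hθ hq.ne_zero hW hbot h
  have hcompl' := H.isCompl_eigenspace_of_inf_eq_bot hirr ((add_comm _ _).trans hc) hne.symm
    ((mul_comm _ _).trans hθ) hq.ne_zero hW hbot h'
  have hdim : finrank F V - finrank F ((t 0).eigenspace θ) = finrank F ((t 0).eigenspace θ) := by
    have h1 := Submodule.finrank_add_eq_of_isCompl hcompl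
    have h2 := Submodule.finrank_add_eq_of_isCompl hcompl'
    have h3 := Submodule.finrank_add_eq_of_isCompl (isCompl_eigenspace hquad hne)
    lia
  have hdet : LinearMap.det (t 0) = 1 := by
    rw [det_eq_pow_mul_pow hquad, hdim, ← mul_pow, hθ, one_pow]
  have h0 := H.invtSubmodule_t_zero_of_isOfFinOrder_det hq (hdet ▸ IsOfFinOrder.one) hW
  have hle : W ≤ (t 0).eigenspace θ' := by
    by_contra hle
    exact inf_eigenspace_ne_bot hquad h0 hle h
  exact hbot (inf_eq_left.2 hle ▸ h')

theorem eq_bot_or_eq_eigenspace_or_eq_top [FiniteDimensional F V] [Nontrivial V]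
    (hq : IsGeneric q) (hW : IsSymInvariant t c W) :
    W = ⊥ ∨ W = (t 0).eigenspace θ ∨ W = (t 0).eigenspace θ' ∨ W = ⊤ := by
  refine or_iff_not_imp_left.2 fun hbot => ?_
  have hc' : θ' + θ = c 0 := (add_comm _ _).trans hc
  obtain h | h := H.inf_eigenspace_ne_bot_or hirr hc hne hθ hq hW hbot
  · have hle := H.eigenspace_le_of_inf_ne_bot hirr hc hne hq.ne_zero hW h
    exact (H.eq_eigenspace_or_eq_top hirr hc hne hθ hq.ne_zero hW hle).imp_right Or.inr
  · have hle := H.eigenspace_le_of_inf_ne_bot hirr hc' hne.symm hq.ne_zero hW h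
    exact Or.inr <| H.eq_eigenspace_or_eq_top hirr hc' hne.symm ((mul_comm _ _).trans hθ)
      hq.ne_zero hW hle

end Distinct

section SelfInverse

variable [FiniteDimensional F V] [Nontrivial V] [IsAlgClosed F] (hq : IsGeneric q)
  (hθ : θ * θ = 1) (hc : θ + θ = c 0)
include hq hθ hc

theorem range_eq_eigenspace_of_even (heven : Even (finrank F V)) :
    (t 0 - θ • 1).range = (t 0).eigenspace θ := by
  have hquad : (t 0 - θ • 1) * (t 0 - θ • 1) = 0 :=
    sub_smul_mul_sub_smul_eq_zero (H.mul_self 0) hθ hc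
  have hsum := finrank_range_sub_smul_add_finrank_eigenspace (t 0) θ
  have hdim := H.two_mul_finrank_eigenspace_le hθ hc hirr hq
  obtain ⟨m, hm⟩ := heven
  exact Submodule.eq_of_le_of_finrank_le (range_sub_smul_le_eigenspace hquad) (by lia)

theorem eq_bot_or_eq_eigenspace_or_eq_top_of_even (heven : Even (finrank F V))
    (hW : IsSymInvariant t c W) : W = ⊥ ∨ W = (t 0).eigenspace θ ∨ W = ⊤ := by
  refine or_iff_not_imp_left.2 fun hbot => ?_
  refine (H.le_eigenspace_or_eq_top hirr hq hθ hc hW).imp_left fun hle => hle.antisymm ?_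
  exact H.range_eq_eigenspace_of_even hirr hq hθ hc heven ▸
    H.range_le_of_le_eigenspace hirr hq.ne_zero hc hW hbot hle

theorem finrank_range_add_one_of_odd (hodd : Odd (finrank F V)) :
    finrank F (t 0 - θ • 1).range + 1 = finrank F ((t 0).eigenspace θ) := by
  have hquad : (t 0 - θ • 1) * (t 0 - θ • 1) = 0 :=
    sub_smul_mul_sub_smul_eq_zero (H.mul_self 0) hθ hc
  have hle := Submodule.finrank_mono (range_sub_smul_le_eigenspace hquad)
  have hsum := finrank_range_sub_smul_add_finrank_eigenspace (t 0) θ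
  have hdim := H.two_mul_finrank_eigenspace_le hθ hc hirr hq
  obtain ⟨m, hm⟩ := hodd
  lia

theorem eq_bot_or_eq_range_or_eq_eigenspace_or_eq_top (hodd : Odd (finrank F V))
    (hW : IsSymInvariant t c W) :
    W = ⊥ ∨ W = (t 0 - θ • 1).range ∨ W = (t 0).eigenspace θ ∨ W = ⊤ := by
  refine or_iff_not_imp_left.2 fun hbot => ?_
  obtain hle | htop := H.le_eigenspace_or_eq_top hirr hq hθ hc hW
  · have hrange := H.range_le_of_le_eigenspace hirr hq.ne_zero hc hW hbot hle
    have hdim := H.finrank_range_add_one_of_odd hirr hq hθ hc hodd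
    by_cases h : finrank F W ≤ finrank F (t 0 - θ • 1).range
    · exact Or.inl (Submodule.eq_of_le_of_finrank_le hrange h).symm
    · exact Or.inr (Or.inl (Submodule.eq_of_le_of_finrank_le hle (by lia)))
  · exact Or.inr (Or.inr htop)

end SelfInverse

theorem eq_bot_or_eq_top_of_eq_smul_one [FiniteDimensional F V] [Nontrivial V] [IsAlgClosed F]
    (hq : IsGeneric q) (h0 : t 0 = θ • 1) (hW : IsSymInvariant t c W) : W = ⊥ ∨ W = ⊤ := by
  refine or_iff_not_imp_left.2 fun hbot => ?_
  have hmem (v : V) : v ∈ (t 0).eigenspace θ := mem_eigenspace_iff.2 (by simp [h0])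
  have htop : (t 0).eigenspace θ = ⊤ := top_unique fun v _ => hmem v
  obtain ⟨v, hv⟩ := exists_ne (0 : V)
  have hθ : θ * (c 0 - θ) = 1 := H.eigenvalue_mul_sub_eq_one ⟨hmem v, hv⟩
  have hc : θ + (c 0 - θ) = c 0 := add_sub_cancel _ _
  obtain heq | hne := eq_or_ne (c 0 - θ) θ
  · rw [heq] at hθ hc
    have hdim := H.two_mul_finrank_eigenspace_le hθ hc hirr hq
    rw [htop, finrank_top] at hdim
    have hpos := Submodule.one_le_finrank_iff.2 hbot
    exact Submodule.eq_top_of_finrank_eq (by have := W.finrank_le; lia)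
  · have hle := H.eigenspace_le_of_inf_ne_bot hirr hc hne.symm hq.ne_zero hW
    rw [htop, inf_top_eq] at hle
    exact top_le_iff.1 (hle hbot)

end IsDAHATuple

end Classification

section Diagonalizable

open Module Module.End

variable {F V : Type*} [Field F] [AddCommGroup V] [Module F V] {f : End F V} {a b : F}

theorem isDiagonalizable_of_eigenspace_eq_top (h : f.eigenspace a = ⊤) : IsDiagonalizable f :=
  top_unique (h ▸ le_iSup f.eigenspace a)

theorem isDiagonalizable_of_ne (h : (f - a • 1) * (f - b • 1) = 0) (hab : a ≠ b) :
    IsDiagonalizable f :=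
  top_unique <| (isCompl_eigenspace h hab).sup_eq_top ▸
    sup_le (le_iSup f.eigenspace a) (le_iSup f.eigenspace b)

theorem IsDiagonalizable.eq_smul_one (hf : IsDiagonalizable f)
    (h : {μ | f.HasEigenvalue μ} = {a}) : f = a • 1 := by
  have hle : ⨆ μ, f.eigenspace μ ≤ f.eigenspace a := iSup_le fun μ => by
    by_cases hμ : f.HasEigenvalue μ
    · rw [(h ▸ hμ : μ ∈ ({a} : Set F))]
    · rw [hasEigenvalue_iff, not_not] at hμ
      exact hμ ▸ bot_le
  ext v
  exact mem_eigenspace_iff.1 (hle (hf ▸ Submodule.mem_top))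

theorem hasEigenvalue_iff_eq [IsAlgClosed F] [FiniteDimensional F V] [Nontrivial V]
    (h : (f - a • 1) * (f - a • 1) = 0) (μ : F) : f.HasEigenvalue μ ↔ μ = a := by
  have heq {ν} (hν : f.HasEigenvalue ν) : ν = a := or_self_iff.1 (eq_or_eq_of_hasEigenvalue h hν)
  refine ⟨heq, ?_⟩
  rintro rfl
  obtain ⟨ν, hν⟩ := Module.End.exists_eigenvalue f
  exact heq hν ▸ hν

theorem range_sub_smul_ne_bot (hf : ¬ IsDiagonalizable f) : (f - a • 1).range ≠ ⊥ := fun h =>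
  hf <| isDiagonalizable_of_eigenspace_eq_top (a := a) <| by
    rw [eigenspace_def, LinearMap.range_eq_bot.1 h, LinearMap.ker_zero]

end Diagonalizable

section Action

open Module

theorem exists_smul_eq_smul_of_mem_center {k A V : Type*} [Field k] [IsAlgClosed k] [Ring A]
    [Algebra k A] [AddCommGroup V] [Module k V] [Module A V] [IsScalarTower k A V]
    [FiniteDimensional k V] [IsSimpleModule A V] {z : A} (hz : z ∈ Set.center A) :
    ∃ r : k, ∀ v : V, z • v = r • v := by
  obtain ⟨r, hr⟩ := (IsSimpleModule.algebraMap_end_bijective_of_isAlgClosed (A := A) (V := V) k).2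
    (Module.End.smulLeft z hz)
  exact ⟨r, fun v => (LinearMap.congr_fun hr v).symm⟩

variable {F : Type*} [Field F] {q : F} {V : Type*} [AddCommGroup V] [Module F V]
  [Module (DAHA q) V] [IsScalarTower F (DAHA q) V]

variable (q V) in
/-- The action of `t_i` on the `ℌ_q`-module `V`; in particular `tEnd q V 0` is `t0End q V`. -/
noncomputable def tEnd (i : Fin 4) : End F V :=
  Algebra.lsmul F F V (DAHA.t q i : DAHA q)

variable (q V) in
theorem exists_isDAHATuple [IsAlgClosed F] [FiniteDimensional F V] [IsSimpleModule (DAHA q) V] :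
    ∃ c, IsDAHATuple q (tEnd q V) c := by
  choose c hc using fun i => exists_smul_eq_smul_of_mem_center (k := F) (V := V)
    (Semigroup.mem_center_iff.2 fun x => (DAHA.central q i x).symm)
  refine ⟨c, fun i => ?_, ?_⟩
  · ext v
    have h := hc i ((DAHA.t q i : DAHA q) • v)
    rw [add_smul, ← mul_smul _ _ v, ← mul_smul _ _ v, Units.inv_mul, one_smul] at h
    exact (mul_smul _ _ v).symm.trans (eq_sub_of_add_eq h)
  · have h := congrArg (Algebra.lsmul F F V) (DAHA.prod q)
    rwa [map_mul, map_mul, map_mul, AlgHom.commutes, Algebra.algebraMap_eq_smul_one] at h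

namespace IsDAHATuple

variable {c : Fin 4 → F} (H : IsDAHATuple q (tEnd q V) c)
include H

theorem lsmul_inv (i : Fin 4) :
    Algebra.lsmul F F V (((DAHA.t q i)⁻¹ : (DAHA q)ˣ) : DAHA q) = tInv (tEnd q V) c i := by
  have h : tEnd q V i * Algebra.lsmul F F V (((DAHA.t q i)⁻¹ : (DAHA q)ˣ) : DAHA q) = 1 := by
    rw [tEnd, ← map_mul, Units.mul_inv, map_one]
  exact (left_inv_eq_right_inv (H.tInv_mul i) h).symm

theorem lsmul_sym (i : Fin 4) :
    Algebra.lsmul F F V (DAHA.sym q i) = sym (tEnd q V) c i := by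
  rw [DAHA.sym, mul_inv_rev, Units.val_mul, Units.val_mul, map_add, map_mul, map_mul, H.lsmul_inv,
    H.lsmul_inv]
  rfl

theorem lsmul_mem_adjoin (x : DAHA q) :
    Algebra.lsmul F F V x ∈ Algebra.adjoin F (Set.range (tEnd q V)) := by
  set S := Algebra.adjoin F (Set.range (tEnd q V))
  have ht (i) : tEnd q V i ∈ S := Algebra.subset_adjoin ⟨i, rfl⟩
  induction x using DAHA.induction with
  | hF r =>
    rw [AlgHom.commutes]
    exact S.algebraMap_mem r
  | ht i => exact ht i
  | htInv i => exact H.lsmul_inv i ▸ S.sub_mem (S.smul_mem S.one_mem _) (ht i)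
  | hadd x y hx hy =>
    rw [map_add]
    exact S.add_mem hx hy
  | hmul x y hx hy =>
    rw [map_mul]
    exact S.mul_mem hx hy

theorem actsIrreducibly [IsSimpleModule (DAHA q) V] : ActsIrreducibly (tEnd q V) := by
  intro W hW
  have hinv (x : DAHA q) : W ∈ (Algebra.lsmul F F V x).invtSubmodule :=
    mem_invtSubmodule_of_mem_adjoin (Set.forall_mem_range.2 hW) (H.lsmul_mem_adjoin x)
  let W' : Submodule (DAHA q) V := { W with smul_mem' := fun x _ hw => hinv x hw }
  have hW' : W'.restrictScalars F = W := rfl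
  rw [← hW', Submodule.restrictScalars_eq_bot_iff, Submodule.restrictScalars_eq_top_iff]
  exact eq_bot_or_eq_top W'

theorem lsmul_zeta_mem_adjoin (hq : IsGeneric q) (x : AW q) :
    Algebra.lsmul F F V (zeta hq x) ∈ Algebra.adjoin F (sym (tEnd q V) c '' {0}ᶜ) := by
  set S := Algebra.adjoin F (sym (tEnd q V) c '' {0}ᶜ)
  have hsym (i : Fin 4) (hi : i ≠ 0) : Algebra.lsmul F F V (DAHA.sym q i) ∈ S :=
    H.lsmul_sym i ▸ Algebra.subset_adjoin ⟨i, hi, rfl⟩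
  induction x using AW.induction with
  | hF r =>
    rw [AlgHom.commutes, AlgHom.commutes]
    exact S.algebraMap_mem r
  | hg g =>
    rw [zeta_gen]
    cases g
    exacts [hsym 1 (by decide), hsym 3 (by decide), hsym 2 (by decide)]
  | hadd x y hx hy =>
    rw [map_add, map_add]
    exact S.add_mem hx hy
  | hmul x y hx hy =>
    rw [map_mul, map_mul]
    exact S.mul_mem hx hy

end IsDAHATuple

end Action

section Pullback

open Module

variable {F : Type*} [Field F] {q : F} (hq : IsGeneric q) {V : Type*} [AddCommGroup V]
  [Module F V] [Module (DAHA q) V] [IsScalarTower F (DAHA q) V]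

/-- The subspace of `V` underlying a `△_q`-submodule. -/
noncomputable def toSubspace : Submodule (AW q) (Pullback hq V) ↪o Submodule F V :=
  (Submodule.restrictScalarsEmbedding F (AW q) (Pullback hq V)).trans
    (Submodule.orderIsoMapComap (Pullback.of hq V)).symm.toOrderEmbedding

variable {hq} {W W' : Submodule (AW q) (Pullback hq V)}

theorem toSubspace_bot : toSubspace hq (⊥ : Submodule (AW q) (Pullback hq V)) = ⊥ := rfl

theorem toSubspace_top : toSubspace hq (⊤ : Submodule (AW q) (Pullback hq V)) = ⊤ := rfl

theorem toSubspace_inj : toSubspace hq W = toSubspace hq W' ↔ W = W' :=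
  (toSubspace hq).injective.eq_iff

theorem finrank_toSubspace : finrank F (toSubspace hq W) = finrank F W := rfl

theorem toSubspace_t0Eigenspace (θ : F) :
    toSubspace hq (t0Eigenspace hq V θ) = (tEnd q V 0).eigenspace θ := by
  ext v
  rw [Module.End.mem_eigenspace_iff]
  rfl

theorem IsDAHATuple.exists_toSubspace_eq_iff {c : Fin 4 → F} (H : IsDAHATuple q (tEnd q V) c)
    {U : Submodule F V} :
    (∃ W, toSubspace hq W = U) ↔ IsSymInvariant (tEnd q V) c U := by
  constructor
  · rintro ⟨W, rfl⟩ i hi w hw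
    have hgen (g : AWGen) : zetaGen q g • w ∈ toSubspace hq W :=
      zeta_gen hq g ▸ W.smul_mem (AW.gen q g) hw
    rw [← H.lsmul_sym i]
    fin_cases i
    exacts [absurd rfl hi, hgen AWGen.A, hgen AWGen.C, hgen AWGen.B]
  · intro hU
    have hinv (x : AW q) : U ∈ (Algebra.lsmul F F V (zeta hq x)).invtSubmodule :=
      mem_invtSubmodule_of_mem_adjoin (by rintro _ ⟨i, hi, rfl⟩; exact hU i hi)
        (H.lsmul_zeta_mem_adjoin hq x)
    let W : Submodule (AW q) (Pullback hq V) :=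
      { U.map (Pullback.of hq V : V →ₗ[F] Pullback hq V) with
        smul_mem' := by
          rintro x _ ⟨u, hu, rfl⟩
          exact ⟨zeta hq x • u, hinv x hu, rfl⟩ }
    exact ⟨W, (Submodule.orderIsoMapComap (Pullback.of hq V)).symm_apply_apply U⟩

theorem IsDAHATuple.isSymInvariant_toSubspace {c : Fin 4 → F} (H : IsDAHATuple q (tEnd q V) c)
    (W : Submodule (AW q) (Pullback hq V)) : IsSymInvariant (tEnd q V) c (toSubspace hq W) :=
  H.exists_toSubspace_eq_iff.1 ⟨W, rfl⟩

theorem bot_lt_t0Eigenspace {θ : F} (h : (t0End q V).HasEigenvalue θ) :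
    ⊥ < t0Eigenspace hq V θ := by
  rw [bot_lt_iff_ne_bot, ne_eq, ← toSubspace_inj, toSubspace_t0Eigenspace]
  exact h

end Pullback

section SubmoduleLattice

open Module

variable {F : Type*} [Field F] {q : F} {hq : IsGeneric q} {V : Type*} [AddCommGroup V]
  [Module F V] [Module (DAHA q) V] [IsScalarTower F (DAHA q) V] {θ θ' : F}

theorem t0Eigenspace_lt_top (hdiag : ¬ IsDiagonalizable (t0End q V)) :
    t0Eigenspace hq V θ < ⊤ := by
  rw [lt_top_iff_ne_top, ne_eq, ← toSubspace_inj, toSubspace_t0Eigenspace, toSubspace_top]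
  exact mt isDiagonalizable_of_eigenspace_eq_top hdiag

theorem ne_bot_of_toSubspace_eq_range (hdiag : ¬ IsDiagonalizable (t0End q V))
    {V' : Submodule (AW q) (Pullback hq V)}
    (hV' : toSubspace hq V' = (tEnd q V 0 - θ • 1).range) : V' ≠ ⊥ := by
  rw [ne_eq, ← toSubspace_inj, hV', toSubspace_bot]
  exact range_sub_smul_ne_bot hdiag

theorem encard_pair_le_two {α : Type*} (a b : α) : ({a, b} : Set α).encard ≤ 2 :=
  (Set.encard_insert_le _ _).trans (by rw [Set.encard_singleton, one_add_one_eq_two])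

theorem ne_and_eq_pair_of_encard_eq_two {α : Type*} {s : Set α} {a b : α} (hs : s ⊆ {a, b})
    (hcard : s.encard = 2) : a ≠ b ∧ s = {a, b} := by
  have heq : s = {a, b} := (Set.toFinite {a, b}).eq_of_subset_of_encard_le' hs
    ((encard_pair_le_two a b).trans hcard.ge)
  refine ⟨?_, heq⟩
  rintro rfl
  rw [heq, Set.pair_eq_singleton, Set.encard_singleton] at hcard
  exact absurd hcard (by decide)

namespace IsDAHATuple

variable {c : Fin 4 → F} (H : IsDAHATuple q (tEnd q V) c)
include H

theorem isCompl_t0Eigenspace (hθ : θ * θ' = 1) (hc : θ + θ' = c 0) (hne : θ ≠ θ') :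
    IsCompl (t0Eigenspace hq V θ) (t0Eigenspace hq V θ') := by
  refine IsCompl.of_orderEmbedding (toSubspace hq) ?_
  rw [toSubspace_t0Eigenspace, toSubspace_t0Eigenspace]
  exact isCompl_eigenspace (sub_smul_mul_sub_smul_eq_zero (H.mul_self 0) hθ hc) hne

variable [FiniteDimensional F V] [IsSimpleModule (DAHA q) V]

theorem eq_bot_or_eq_t0Eigenspace_or_eq_top (hθ : θ * θ' = 1) (hc : θ + θ' = c 0) (hne : θ ≠ θ')
    (W : Submodule (AW q) (Pullback hq V)) :
    W = ⊥ ∨ W = t0Eigenspace hq V θ ∨ W = t0Eigenspace hq V θ' ∨ W = ⊤ := by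
  have := IsSimpleModule.nontrivial (DAHA q) V
  simpa only [← toSubspace_t0Eigenspace (hq := hq), ← toSubspace_bot (hq := hq),
    ← toSubspace_top (hq := hq), toSubspace_inj] using
    H.eq_bot_or_eq_eigenspace_or_eq_top H.actsIrreducibly hc hne hθ hq
      (H.isSymInvariant_toSubspace W)

theorem t0Eigenspace_diamond (hθ : θ * θ' = 1) (hc : θ + θ' = c 0) (hne : θ ≠ θ')
    (hev : (t0End q V).HasEigenvalue θ) (hev' : (t0End q V).HasEigenvalue θ') :
    ⊥ < t0Eigenspace hq V θ ∧ t0Eigenspace hq V θ < ⊤ ∧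
      ⊥ < t0Eigenspace hq V θ' ∧ t0Eigenspace hq V θ' < ⊤ ∧
      IsCompl (t0Eigenspace hq V θ) (t0Eigenspace hq V θ') ∧
      ∀ W : Submodule (AW q) (Pullback hq V),
        W = ⊥ ∨ W = t0Eigenspace hq V θ ∨ W = t0Eigenspace hq V θ' ∨ W = ⊤ := by
  have hpos : ⊥ < t0Eigenspace hq V θ := bot_lt_t0Eigenspace hev
  have hpos' : ⊥ < t0Eigenspace hq V θ' := bot_lt_t0Eigenspace hev'
  have hcompl := H.isCompl_t0Eigenspace (hq := hq) hθ hc hne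
  exact ⟨hpos, (hcompl.symm.disjoint.ne_top_of_ne_bot hpos'.ne').lt_top,
    hpos', (hcompl.disjoint.ne_top_of_ne_bot hpos.ne').lt_top,
    hcompl, H.eq_bot_or_eq_t0Eigenspace_or_eq_top hθ hc hne⟩

variable [IsAlgClosed F]

theorem isSimpleModule_pullback_of_eq_smul_one (h0 : t0End q V = θ • 1) :
    IsSimpleModule (AW q) (Pullback hq V) := by
  have := IsSimpleModule.nontrivial (DAHA q) V
  have : Nontrivial (Pullback hq V) := ‹Nontrivial V›
  refine (isSimpleModule_iff _ _).2 ⟨fun W => ?_⟩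
  simpa only [← toSubspace_bot (hq := hq), ← toSubspace_top (hq := hq), toSubspace_inj] using
    H.eq_bot_or_eq_top_of_eq_smul_one H.actsIrreducibly hq h0 (H.isSymInvariant_toSubspace W)

section SelfInverse

variable (hθ : θ * θ = 1) (hc : θ + θ = c 0)
include hθ hc

theorem eq_bot_or_eq_t0Eigenspace_or_eq_top_of_even (heven : Even (finrank F V))
    (W : Submodule (AW q) (Pullback hq V)) :
    W = ⊥ ∨ W = t0Eigenspace hq V θ ∨ W = ⊤ := by
  have := IsSimpleModule.nontrivial (DAHA q) V
  simpa only [← toSubspace_t0Eigenspace (hq := hq), ← toSubspace_bot (hq := hq),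
    ← toSubspace_top (hq := hq), toSubspace_inj] using
    H.eq_bot_or_eq_eigenspace_or_eq_top_of_even H.actsIrreducibly hq hθ hc heven
      (H.isSymInvariant_toSubspace W)

variable (hodd : Odd (finrank F V))
include hodd

section Range

variable {V' : Submodule (AW q) (Pullback hq V)}
  (hV' : toSubspace hq V' = (tEnd q V 0 - θ • 1).range)
include hV'

theorem finrank_add_one_of_toSubspace_eq_range :
    finrank F V' + 1 = finrank F (t0Eigenspace hq V θ) := by
  have := IsSimpleModule.nontrivial (DAHA q) V
  rw [← finrank_toSubspace, ← finrank_toSubspace, hV', toSubspace_t0Eigenspace]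
  exact H.finrank_range_add_one_of_odd H.actsIrreducibly hq hθ hc hodd

theorem lt_t0Eigenspace_of_toSubspace_eq_range : V' < t0Eigenspace hq V θ := by
  refine lt_of_le_of_ne ?_ fun h => ?_
  · rw [← (toSubspace hq).le_iff_le, hV', toSubspace_t0Eigenspace]
    exact range_sub_smul_le_eigenspace (sub_smul_mul_sub_smul_eq_zero (H.mul_self 0) hθ hc)
  · have hcodim := H.finrank_add_one_of_toSubspace_eq_range hθ hc hodd hV'
    rw [h] at hcodim
    exact Nat.succ_ne_self _ hcodim

theorem eq_bot_or_eq_or_eq_t0Eigenspace_or_eq_top (W : Submodule (AW q) (Pullback hq V)) :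
    W = ⊥ ∨ W = V' ∨ W = t0Eigenspace hq V θ ∨ W = ⊤ := by
  have := IsSimpleModule.nontrivial (DAHA q) V
  simpa only [← hV', ← toSubspace_t0Eigenspace (hq := hq), ← toSubspace_bot (hq := hq),
    ← toSubspace_top (hq := hq), toSubspace_inj] using
    H.eq_bot_or_eq_range_or_eq_eigenspace_or_eq_top H.actsIrreducibly hq hθ hc hodd
      (H.isSymInvariant_toSubspace W)

theorem isAtom_of_toSubspace_eq_range (hbot : V' ≠ ⊥) : IsAtom V' := by
  refine ⟨hbot, fun U hU => ?_⟩
  have hlt := H.lt_t0Eigenspace_of_toSubspace_eq_range hθ hc hodd hV'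
  obtain h | rfl | rfl | rfl := H.eq_bot_or_eq_or_eq_t0Eigenspace_or_eq_top hθ hc hodd hV' U
  exacts [h, absurd hU (lt_irrefl _), absurd hU hlt.not_gt, absurd hU not_top_lt]

theorem le_and_isSimpleModule_and_finrank_add_one_iff (hbot : V' ≠ ⊥)
    (htop : t0Eigenspace hq V θ < ⊤) (W : Submodule (AW q) (Pullback hq V)) :
    (W ≤ t0Eigenspace hq V θ ∧ IsSimpleModule (AW q) W ∧
      finrank F W + 1 = finrank F (t0Eigenspace hq V θ)) ↔ W = V' := by
  constructor
  · rintro ⟨hle, hsimple, hcodim⟩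
    obtain rfl | h | rfl | rfl := H.eq_bot_or_eq_or_eq_t0Eigenspace_or_eq_top hθ hc hodd hV' W
    · exact absurd rfl (isSimpleModule_iff_isAtom.1 hsimple).1
    · exact h
    · exact absurd hcodim (Nat.succ_ne_self _)
    · exact absurd hle htop.not_ge
  · rintro rfl
    exact ⟨(H.lt_t0Eigenspace_of_toSubspace_eq_range hθ hc hodd hV').le,
      isSimpleModule_iff_isAtom.2 (H.isAtom_of_toSubspace_eq_range hθ hc hodd hV' hbot),
      H.finrank_add_one_of_toSubspace_eq_range hθ hc hodd hV'⟩

end Range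

theorem exists_chain_of_odd (hdiag : ¬ IsDiagonalizable (t0End q V)) :
    ∃ V' : Submodule (AW q) (Pullback hq V),
      (∀ W : Submodule (AW q) (Pullback hq V),
        (W ≤ t0Eigenspace hq V θ ∧ IsSimpleModule (AW q) W ∧
          finrank F W + 1 = finrank F (t0Eigenspace hq V θ)) ↔ W = V') ∧
      ⊥ < V' ∧ V' < t0Eigenspace hq V θ ∧ t0Eigenspace hq V θ < ⊤ ∧
      ∀ W : Submodule (AW q) (Pullback hq V),
        W = ⊥ ∨ W = V' ∨ W = t0Eigenspace hq V θ ∨ W = ⊤ := by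
  have htop : t0Eigenspace hq V θ < ⊤ := t0Eigenspace_lt_top hdiag
  obtain ⟨V', hV'⟩ := H.exists_toSubspace_eq_iff (hq := hq).2 (H.isSymInvariant_range θ)
  have hbot := ne_bot_of_toSubspace_eq_range hdiag hV'
  exact ⟨V', H.le_and_isSimpleModule_and_finrank_add_one_iff hθ hc hodd hV' hbot htop,
    bot_lt_iff_ne_bot.2 hbot, H.lt_t0Eigenspace_of_toSubspace_eq_range hθ hc hodd hV', htop,
    H.eq_bot_or_eq_or_eq_t0Eigenspace_or_eq_top hθ hc hodd hV'⟩

end SelfInverse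

end IsDAHATuple

end SubmoduleLattice

end AskeyWilson

open AskeyWilson in
theorem theorem5p1 {F : Type*} [Field F] [IsAlgClosed F] {q : F} (hq : IsGeneric q)
    (V : Type*) [AddCommGroup V] [Module F V] [Module (DAHA q) V] [IsScalarTower F (DAHA q) V]
    [FiniteDimensional F V] [IsSimpleModule (DAHA q) V] :
    (¬ IsDiagonalizable (t0End q V) →
      ∃ θ : F, (θ = 1 ∨ θ = -1) ∧
        (∀ μ : F, (t0End q V).HasEigenvalue μ ↔ μ = θ) ∧
        (Even (Module.finrank F V) →
          ⊥ < t0Eigenspace hq V θ ∧ t0Eigenspace hq V θ < ⊤ ∧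
          ∀ W : Submodule (AW q) (Pullback hq V),
            W = ⊥ ∨ W = t0Eigenspace hq V θ ∨ W = ⊤) ∧
        (Odd (Module.finrank F V) →
          ∃ V' : Submodule (AW q) (Pullback hq V),
            (∀ W : Submodule (AW q) (Pullback hq V),
              (W ≤ t0Eigenspace hq V θ ∧ IsSimpleModule (AW q) W ∧
                Module.finrank F W + 1 = Module.finrank F (t0Eigenspace hq V θ)) ↔ W = V') ∧
            ⊥ < V' ∧ V' < t0Eigenspace hq V θ ∧ t0Eigenspace hq V θ < ⊤ ∧
            ∀ W : Submodule (AW q) (Pullback hq V),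
              W = ⊥ ∨ W = V' ∨ W = t0Eigenspace hq V θ ∨ W = ⊤)) ∧
    (IsDiagonalizable (t0End q V) →
      {μ : F | (t0End q V).HasEigenvalue μ}.encard ≤ 2 ∧
      ({μ : F | (t0End q V).HasEigenvalue μ}.encard = 1 →
        IsSimpleModule (AW q) (Pullback hq V) ∧ Module.finrank F V ≤ 2) ∧
      ({μ : F | (t0End q V).HasEigenvalue μ}.encard = 2 →
        ∃ θ : F, θ ≠ 0 ∧ θ ≠ 1 ∧ θ ≠ -1 ∧
          {μ : F | (t0End q V).HasEigenvalue μ} = {θ, θ⁻¹} ∧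
          ⊥ < t0Eigenspace hq V θ ∧ t0Eigenspace hq V θ < ⊤ ∧
          ⊥ < t0Eigenspace hq V θ⁻¹ ∧ t0Eigenspace hq V θ⁻¹ < ⊤ ∧
          IsCompl (t0Eigenspace hq V θ) (t0Eigenspace hq V θ⁻¹) ∧
          ∀ W : Submodule (AW q) (Pullback hq V),
            W = ⊥ ∨ W = t0Eigenspace hq V θ ∨ W = t0Eigenspace hq V θ⁻¹ ∨ W = ⊤)) := by
  have := IsSimpleModule.nontrivial (DAHA q) V
  obtain ⟨c, H⟩ := exists_isDAHATuple q V
  obtain ⟨θ, θ', hθ, hc⟩ := exists_mul_eq_one_add_eq (c 0)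
  have hquad : (t0End q V - θ • 1) * (t0End q V - θ' • 1) = 0 :=
    sub_smul_mul_sub_smul_eq_zero (H.mul_self 0) hθ hc
  have hsub : {μ | (t0End q V).HasEigenvalue μ} ⊆ {θ, θ'} :=
    fun μ => eq_or_eq_of_hasEigenvalue hquad
  refine ⟨fun hdiag => ?_, fun hdiag =>
    ⟨(Set.encard_le_encard hsub).trans (encard_pair_le_two θ θ'), fun hcard => ?_, fun hcard => ?_⟩⟩
  · obtain rfl : θ = θ' := by_contra fun hne => hdiag (isDiagonalizable_of_ne hquad hne)
    exact ⟨θ, mul_self_eq_one_iff.1 hθ, hasEigenvalue_iff_eq hquad,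
      fun heven => ⟨bot_lt_t0Eigenspace ((hasEigenvalue_iff_eq hquad θ).2 rfl),
        t0Eigenspace_lt_top hdiag,
        H.eq_bot_or_eq_t0Eigenspace_or_eq_top_of_even hθ hc heven⟩,
      fun hodd => H.exists_chain_of_odd hθ hc hodd hdiag⟩
  · obtain ⟨μ, hμ⟩ := Set.encard_eq_one.1 hcard
    have h0 := hdiag.eq_smul_one hμ
    exact ⟨H.isSimpleModule_pullback_of_eq_smul_one h0,
      H.finrank_le_two_of_eq_smul_one H.actsIrreducibly hq.ne_zero h0⟩
  · obtain ⟨hne, heq⟩ := ne_and_eq_pair_of_encard_eq_two hsub hcard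
    obtain rfl : θ' = θ⁻¹ := eq_inv_of_mul_eq_one_right hθ
    exact ⟨θ, left_ne_zero_of_mul_eq_one hθ, fun h => hne (by rw [h, inv_one]),
      fun h => hne (by rw [h, inv_neg_one]), heq,
      H.t0Eigenspace_diamond hθ hc hne (heq.ge (Set.mem_insert _ _))
        (heq.ge (Set.mem_insert_of_mem _ rfl))⟩
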